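/- **Setting.** Let $\gamma$ be a random variable with values in $[0,\infty]$ on a probability space $(\Omega,\mathscr F,\mathsf P)$ with $\mathsf P(\gamma>0)>0$. Put $G(t)=\mathsf P(\gamma\le t)$ and $\overline G(t)=1-G(t)$ for $t\in[0,\infty)$, $t_G=\sup\{t\in[0,\infty):G(t)<1\}$ and $\mathcal T=\{t\in[0,\infty):\mathsf P(\gamma\ge t)>0\}$; the measure $dG$ on $[0,\infty)$ has mass $G(0)$ at $0$. Case A means $\mathsf P(\gamma=t_G<\infty)=0$ and Case B means $\mathsf P(\gamma=t_G<\infty)>0$. The single jump filtration is $(\mathscr F_t)_{t\ge0}$, where $\mathscr F_t$ consists of those $A\in\mathscr F$ for which $A\cap\{t<\gamma\}$ is either $\varnothing$ or $\{t<\gamma\}$. Martingale notions refer to this filtration (no completion), processes are adapted with almost all paths càdlàg, and a local martingale is a process $M$ for which there are stopping times $T_n\uparrow\infty$ a.s. such that every stopped process $M^{T_n}$ is a uniformly integrable martingale. Let $L^1_{\rm loc}(dG)$ be the set of Borel functions $z$ on $\mathcal T$ with $\int_{[0,t]}|z|\,dG<\infty$ for all $t\in\mathcal T$. For $F\colon[0,t_G)\to\mathbb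 R$ write $F\overset{\rm loc}{\ll}G$ and $\frac{dF}{dG}=z$ if $z\in L^1_{\rm loc}(dG)$ and $F(t)=F(0)+\int_{(0,t]}z\,dG$ for all $t<t_G$ (the value $z(0)$ is irrelevant). A pair $(F,H)$ satisfies Condition M if $F\overset{\rm loc}{\ll}G$, $H\in L^1_{\rm loc}(dG)$, $F(t)\overline G(t)+\int_{(0,t]}H\,dG=F(0)\overline G(0)$ for all $t<t_G$ and, in Case B, additionally $\lim_{t\uparrow t_G}F(t)=H(t_G)$. **Types.** Let $M_\infty=\lim_{t\to\infty}M_t$. Let $\mathrm{Var}(M)_\infty$ be the total variation of $M$ over $[0,\infty)$, including $|M_0|$. A local martingale $M$ has * type 1 if with positive probability $M_\infty$ does not exist, or if it exists a.s. but $\mathsf E|M_\infty|=\infty$; * type 2a (resp. 2b) if $M$ is a closed supermartingale (resp. submartingale), i.e. $(M_t)_{0\le t\le\infty}$ is a supermartingale (resp. submartingale), in particular $\mathsf E|M_\infty|<\infty$, and $\mathsf E M_\infty<\mathsf E M_0$ (resp. $\mathsf E M_\infty>\mathsf E M_0$); * type 3 if $M$ is a uniformly integrable martingale and $\mathsf E\sup_t|M_t|=\infty$;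 * type 4 if $\mathsf E\,\mathrm{Var}(M)_\infty<\infty$. **Theorem.** Let $M$ be a local martingale that is indistinguishable from $$F(t)\mathbf 1_{\{t<\gamma\}}+(H(\gamma)+L')\mathbf 1_{\{t\ge\gamma\}},\qquad t\in[0,\infty),$$ where $(F,H)$ satisfies Condition M and $L'$ is a random variable with $\mathsf E(|L'|\mathbf 1_{\{\gamma\le t\}})<\infty$ for all $t\in\mathcal T$ and $\mathsf E[L'\mid\gamma]=0$ (generalized conditional expectation, that is, $\mathsf E[|L'|\mid\gamma]<\infty$ and $\mathsf E[L'^+\mid\gamma]=\mathsf E[L'^-\mid\gamma]$ a.s.). In Case B, $M$ has type 4. In Case A all types are possible: for each of the types 1, 2a, 2b, 3, 4 there are a probability space, a $\gamma$ in Case A and such an $M$ of that type. Moreover, in Case A: (i) $M$ has type 1 if and only if $\mathsf E(|L'|\mathbf 1_{\{\gamma<\infty\}})=\infty$ or $\int_{[0,t_G)}|H|\,dG=\infty$. (ii) If $\mathsf P(\gamma=\infty)>0$, $\mathsf E(|L'|\mathbf 1_{\{\gamma<\infty\}})<\infty$ and $\int_{[0,\infty)}|H|\,dG<\infty$, then $M$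 has type 4. (iii) If $\mathsf P(\gamma=\infty)=0$, $\mathsf E|L'|<\infty$ and $\int_{[0,t_G)}|H|\,dG<\infty$, then the limit $\ell=\lim_{t\uparrow t_G}F(t)\overline G(t)$ exists in $\mathbb R$, and * $M$ has type 2a (resp. 2b) if and only if $\ell>0$ (resp. $\ell<0$); * $M$ has type 3 if and only if $\ell=0$ and $\int_{[0,t_G)}\overline G\,\bigl|\frac{dF}{dG}\bigr|\,dG=\infty$; * $M$ has type 4 if and only if $\int_{[0,t_G)}\overline G\,\bigl|\frac{dF}{dG}\bigr|\,dG<\infty$. -/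

import Mathlib

open Set Filter Topology MeasureTheory ProbabilityTheory
open scoped NNReal ENNReal

noncomputable section

namespace SingleJump

/-! ### Objects attached to a law `ν` on `[0, ∞]`: the law of the jump time -/

/-- The distribution function `G(t) = ν([0, t])`, `t ∈ [0, ∞)`. -/
def cdfG (ν : Measure ℝ≥0∞) (t : ℝ≥0) : ℝ := ν.real (Iic (t : ℝ≥0∞))

/-- The tail `1 - G(t)`. -/
def tailG (ν : Measure ℝ≥0∞) (t : ℝ≥0) : ℝ := 1 - cdfG ν t

/-- The right endpoint `t_G = sup {t ∈ [0, ∞) : G(t) < 1}`, an element of `[0, ∞]`. -/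
def endpoint (ν : Measure ℝ≥0∞) : ℝ≥0∞ :=
  sSup ((fun t : ℝ≥0 => (t : ℝ≥0∞)) '' {t | cdfG ν t < 1})

/-- The set of times `t ∈ [0, ∞)` such that `ν([t, ∞]) > 0`. -/
def timeSet (ν : Measure ℝ≥0∞) : Set ℝ≥0 := {t | 0 < ν (Ici (t : ℝ≥0∞))}

/-- The interval `[0, t_G)`. -/
def beforeEnd (ν : Measure ℝ≥0∞) : Set ℝ≥0 := {t | (t : ℝ≥0∞) < endpoint ν}

/-- The Lebesgue–Stieltjes measure `dG` on `[0, ∞)` (with mass `G(0)` at `0`), that is,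
the restriction of `ν` to `[0, ∞)`. -/
def dG (ν : Measure ℝ≥0∞) : Measure ℝ≥0 := ν.comap (fun t : ℝ≥0 => (t : ℝ≥0∞))

/-- The filter of `t → t_G`, `t < t_G`, on `[0, ∞)` (`t_G` may be finite or infinite). -/
def toEnd (ν : Measure ℝ≥0∞) : Filter ℝ≥0 :=
  comap (fun t : ℝ≥0 => (t : ℝ≥0∞)) (𝓝[<] (endpoint ν))

/-- Case A: there is no atom at a finite right endpoint. -/
def CaseA (ν : Measure ℝ≥0∞) : Prop := ν {x | x = endpoint ν ∧ x < ∞} = 0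

/-- Case B: there is an atom at a finite right endpoint. -/
def CaseB (ν : Measure ℝ≥0∞) : Prop := 0 < ν {x | x = endpoint ν ∧ x < ∞}

/-- `z` is a Borel function on the set `timeSet ν` which is `dG`-integrable over `[0, t]` for every
`t` in this set. Only the values of `z` on `timeSet ν` matter. -/
def MemL1loc (ν : Measure ℝ≥0∞) (z : ℝ≥0 → ℝ) : Prop :=
  Measurable (fun t : timeSet ν => z t) ∧ ∀ t ∈ timeSet ν, IntegrableOn z (Iic t) (dG ν)

/-- `z` is a version of the derivative `dF/dG`: it belongs to `L¹_loc(dG)` and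
`F(t) = F(0) + ∫_{(0,t]} z dG` for `t < t_G`. -/
def IsDensity (ν : Measure ℝ≥0∞) (F z : ℝ≥0 → ℝ) : Prop :=
  MemL1loc ν z ∧ ∀ t ∈ beforeEnd ν, F t = F 0 + ∫ s in Ioc 0 t, z s ∂(dG ν)

/-- Condition M for a pair `(F, H)`. Only the values of `F` on `[0, t_G)` and of `H` on
`timeSet ν` matter. -/
structure ConditionM (ν : Measure ℝ≥0∞) (F H : ℝ≥0 → ℝ) : Prop where
  absCont : ∃ z, IsDensity ν F z
  memL1loc : MemL1loc ν H
  main : ∀ t ∈ beforeEnd ν, F t * tailG ν t + ∫ s in Ioc 0 t, H s ∂(dG ν) = F 0 * tailG ν 0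
  mainB : CaseB ν → Tendsto F (toEnd ν) (𝓝 (H (endpoint ν).toNNReal))

/-! ### The single jump filtration and local martingales -/

variable {Ω : Type*} [mΩ : MeasurableSpace Ω]

/-- The single jump filtration generated by `γ`: `A` belongs to its `t`-th `σ`-field iff `A` is
measurable and `A ∩ {t < γ}` is either empty or the whole `{t < γ}`. -/
def singleJumpFiltration (γ : Ω → ℝ≥0∞) : Filtration ℝ≥0 mΩ where
  seq t :=
    { MeasurableSet' := fun A => MeasurableSet A ∧
        (A ∩ {ω | (t : ℝ≥0∞) < γ ω} = ∅ ∨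
          A ∩ {ω | (t : ℝ≥0∞) < γ ω} = {ω | (t : ℝ≥0∞) < γ ω})
      measurableSet_empty := ⟨MeasurableSet.empty, Or.inl (by simp)⟩
      measurableSet_compl := by
        rintro A ⟨hA, h | h⟩
        · refine ⟨hA.compl, Or.inr ?_⟩
          rw [inter_eq_right]
          intro ω hω hωA
          have : ω ∈ A ∩ {ω | (t : ℝ≥0∞) < γ ω} := ⟨hωA, hω⟩
          rw [h] at this
          exact this
        · refine ⟨hA.compl, Or.inl ?_⟩
          rw [inter_eq_right] at h
          ext ω
          simp only [mem_inter_iff, mem_compl_iff, mem_empty_iff_false, iff_false, not_and]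
          exact fun h1 h2 => h1 (h h2)
      measurableSet_iUnion := by
        intro A hA
        refine ⟨MeasurableSet.iUnion fun i => (hA i).1, ?_⟩
        by_cases h : ∃ i, A i ∩ {ω | (t : ℝ≥0∞) < γ ω} = {ω | (t : ℝ≥0∞) < γ ω}
        · obtain ⟨i, hi⟩ := h
          right
          rw [inter_eq_right] at hi ⊢
          exact hi.trans (subset_iUnion A i)
        · left
          push Not at h
          rw [iUnion_inter]
          exact iUnion_eq_empty.2 fun i => (hA i).2.resolve_right (h i) }
  mono' := by
    rintro s t hst A ⟨hA, h⟩
    refine ⟨hA, ?_⟩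
    have hsub : {ω | (t : ℝ≥0∞) < γ ω} ⊆ {ω | (s : ℝ≥0∞) < γ ω} := fun ω hω =>
      lt_of_le_of_lt (ENNReal.coe_le_coe.2 hst) hω
    rcases h with h | h
    · left
      exact subset_eq_empty (inter_subset_inter_right A hsub) h
    · right
      rw [inter_eq_right] at h ⊢
      exact hsub.trans h
  le' := fun _ _ hA => hA.1

/-- Almost all paths are right-continuous and have finite left-hand limits on `(0, ∞)`. -/
def AECadlag (P : Measure Ω) (M : ℝ≥0 → Ω → ℝ) : Prop :=
  ∀ᵐ ω ∂P, ∀ t : ℝ≥0, ContinuousWithinAt (fun s => M s ω) (Ici t) t ∧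
    ∃ l : ℝ, Tendsto (fun s => M s ω) (𝓝[<] t) (𝓝 l)

/-- A uniformly integrable martingale. -/
def IsUIMartingale (𝓕 : Filtration ℝ≥0 mΩ) (P : Measure Ω) (M : ℝ≥0 → Ω → ℝ) : Prop :=
  Martingale M 𝓕 P ∧ UniformIntegrable M 1 P

/-- A local martingale: an adapted process with almost all paths càdlàg, such that there are
stopping times `T n`, a.s. increasing to `∞`, for which the stopped processes are uniformly
integrable martingales. -/
structure IsLocalMartingale (𝓕 : Filtration ℝ≥0 mΩ) (P : Measure Ω) (M : ℝ≥0 → Ω → ℝ) :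
    Prop where
  adapted : StronglyAdapted 𝓕 M
  cadlag : AECadlag P M
  localized : ∃ T : ℕ → Ω → WithTop ℝ≥0, IsLocalizingSequence 𝓕 T P ∧
    ∀ n, IsUIMartingale 𝓕 P (stoppedProcess M (T n))

/-! ### Global behaviour -/

/-- Almost all paths have a finite limit as `t → ∞`. -/
def HasLimit (P : Measure Ω) (M : ℝ≥0 → Ω → ℝ) : Prop :=
  ∀ᵐ ω ∂P, ∃ l : ℝ, Tendsto (fun t => M t ω) atTop (𝓝 l)

/-- The terminal value `M_∞ = lim_{t → ∞} M_t` (meaningful where the limit exists). -/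
def terminal (M : ℝ≥0 → Ω → ℝ) (ω : Ω) : ℝ := limUnder atTop (fun t => M t ω)

/-- A closed supermartingale: `(M_t)_{0 ≤ t ≤ ∞}` is a supermartingale, where `M_∞` is the a.s.
limit of `M`. -/
structure IsClosedSupermartingale (𝓕 : Filtration ℝ≥0 mΩ) (P : Measure Ω) (M : ℝ≥0 → Ω → ℝ) :
    Prop where
  supermartingale : Supermartingale M 𝓕 P
  hasLimit : HasLimit P M
  integrable : Integrable (terminal M) P
  closed : ∀ t, P[terminal M | 𝓕 t] ≤ᵐ[P] M t

/-- A closed submartingale: `(M_t)_{0 ≤ t ≤ ∞}` is a submartingale, where `M_∞` is the a.s.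
limit of `M`. -/
structure IsClosedSubmartingale (𝓕 : Filtration ℝ≥0 mΩ) (P : Measure Ω) (M : ℝ≥0 → Ω → ℝ) :
    Prop where
  submartingale : Submartingale M 𝓕 P
  hasLimit : HasLimit P M
  integrable : Integrable (terminal M) P
  closed : ∀ t, M t ≤ᵐ[P] P[terminal M | 𝓕 t]

/-- Total variation over `[0, ∞)` of a path, the initial value `|M_0|` being counted as the
variation at `0`. -/
def totalVar (M : ℝ≥0 → Ω → ℝ) (ω : Ω) : ℝ≥0∞ :=
  ‖M 0 ω‖ₑ + eVariationOn (fun t => M t ω) univ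

/-- Names of the types of global behaviour. -/
inductive GlobalType : Type
  | type1
  | type2a
  | type2b
  | type3
  | type4

/-- The local martingale `M` has the given type. -/
def HasType (𝓕 : Filtration ℝ≥0 mΩ) (P : Measure Ω) (M : ℝ≥0 → Ω → ℝ) : GlobalType → Prop
  | .type1 => ¬ HasLimit P M ∨ (HasLimit P M ∧ ∫⁻ ω, ‖terminal M ω‖ₑ ∂P = ∞)
  | .type2a => IsClosedSupermartingale 𝓕 P M ∧ ∫ ω, terminal M ω ∂P < ∫ ω, M 0 ω ∂P
  | .type2b => IsClosedSubmartingale 𝓕 P M ∧ ∫ ω, M 0 ω ∂P < ∫ ω, terminal M ω ∂P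
  | .type3 => IsUIMartingale 𝓕 P M ∧ ∫⁻ ω, (⨆ t, ‖M t ω‖ₑ) ∂P = ∞
  | .type4 => ∫⁻ ω, totalVar M ω ∂P < ∞

/-! ### The representation -/

/-- `E[X | γ] = 0` for a random variable `X` that need not be integrable: `E[|X| | γ] < ∞` a.s. and
`E[X⁺ | γ] = E[X⁻ | γ]` a.s. -/
def CondExpZero (P : Measure Ω) (γ : Ω → ℝ≥0∞) (X : Ω → ℝ) : Prop :=
  (∀ᵐ ω ∂P, condLExp (MeasurableSpace.comap γ inferInstance) P (fun ω' => ‖X ω'‖ₑ) ω < ∞) ∧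
  condLExp (MeasurableSpace.comap γ inferInstance) P (fun ω => ENNReal.ofReal (X ω)) =ᵐ[P]
    condLExp (MeasurableSpace.comap γ inferInstance) P (fun ω => ENNReal.ofReal (-X ω))

/-- `M` is a local martingale for the single jump filtration generated by `γ`, and, up to
indistinguishability, `M_t = F(t) 1_{t < γ} + (H(γ) + L') 1_{t ≥ γ}`, where `(F, H)` satisfies
Condition M, `E(|L'| 1_{γ ≤ t}) < ∞` for all `t ∈ timeSet` and `E[L' | γ] = 0`. -/
structure IsRepresentedLocalMartingale (P : Measure Ω) (γ : Ω → ℝ≥0∞) (F H : ℝ≥0 → ℝ)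
    (L' : Ω → ℝ) (M : ℝ≥0 → Ω → ℝ) : Prop where
  localMartingale : IsLocalMartingale (singleJumpFiltration γ) P M
  conditionM : ConditionM (P.map γ) F H
  measurable_L' : Measurable L'
  integrableOn_L' : ∀ t ∈ timeSet (P.map γ), IntegrableOn L' {ω | γ ω ≤ (t : ℝ≥0∞)} P
  condExpZero_L' : CondExpZero P γ L'
  representation : ∀ᵐ ω ∂P, ∀ t : ℝ≥0,
    M t ω = ({ω' | (t : ℝ≥0∞) < γ ω'}.indicator (fun _ => F t) ω) +
      {ω' | γ ω' ≤ (t : ℝ≥0∞)}.indicator (fun ω' => H (γ ω').toNNReal + L' ω') ω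

end SingleJump

end

/-!
On `{t < γ}` every `𝓕_t`-measurable variable is constant. Put `X = H(γ) + L'`, the value of `M`
after the jump. Since `E[L' | γ] = 0`, Condition M says that the defect `F(t) Ḡ(t) - E[X; t < γ]`
does not depend on `t < t_G` once `X` is integrable, so in Case A with `γ < ∞` a.s. it equals
`ℓ = lim F Ḡ`, and `M` is a closed supermartingale, a closed submartingale or a uniformly integrable
martingale according to the sign of `ℓ`.

Integrating Condition M by parts gives `Ḡ dF/dG = F_- - H`. When `H` is integrable, the conditions
`E Var(M)_∞ < ∞`, `∫ Ḡ |dF/dG| dG < ∞` and `E sup |M| < ∞` are therefore equivalent: the first two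
through the variation of `F` up to `γ`, the last two because `F_-(γ)` is a limit of values of `M`.
Type 1 comes from the conditional Jensen inequality `E |H(γ)| ≤ E |H(γ) + L'|`.

All types occur for `L' = 0` and a geometric `γ`, where `F Ḡ` may be any prescribed sequence on `ℕ`.
-/

namespace SingleJump

/-! ### Measure-theoretic preliminaries -/

lemma ae_eq_zero_of_forall_setIntegral_Iic {α E : Type*} [TopologicalSpace α]
    [SecondCountableTopology α] [LinearOrder α] [OrderTopology α] [MeasurableSpace α]
    [BorelSpace α] [NoMaxOrder α] [Nonempty α] [(atTop : Filter α).IsCountablyGenerated]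
    [NormedAddCommGroup E] [NormedSpace ℝ E] [CompleteSpace E] {μ : Measure α} {g : α → E}
    (hg : Integrable g μ) (h : ∀ t, ∫ s in Iic t, g s ∂μ = 0) : g =ᵐ[μ] 0 := by
  have h_univ : ∫ s, g s ∂μ = 0 := by
    refine tendsto_nhds_unique
      ((aecover_Iic tendsto_id).integral_tendsto_of_countably_generated hg) ?_
    simp only [id_eq, h, tendsto_const_nhds]
  refine hg.ae_eq_zero_of_forall_setIntegral_eq_zero fun s hs hμs => ?_
  clear hμs
  induction s, hs using MeasurableSpace.induction_on_inter
    ((BorelSpace.measurable_eq (α := α)).trans (borel_eq_generateFrom_Iic α)) isPiSystem_Iic with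
  | empty => simp
  | basic s hs => obtain ⟨t, rfl⟩ := hs; exact h t
  | compl s hs ih => rw [setIntegral_compl hs hg, h_univ, ih, sub_zero]
  | iUnion f hd hf ih => rw [integral_iUnion hf hd hg.integrableOn]; simp only [ih, tsum_zero]

lemma tendsto_setIntegral_of_eventually_mem_iff {α ι E : Type*} [MeasurableSpace α]
    {μ : Measure α} [NormedAddCommGroup E] [NormedSpace ℝ E] {l : Filter ι}
    [l.IsCountablyGenerated] {f : α → E} {A : ι → Set α} {B : Set α} (hf : Integrable f μ)
    (hA : ∀ i, MeasurableSet (A i)) (hB : MeasurableSet B)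
    (h : ∀ᵐ x ∂μ, ∀ᶠ i in l, (x ∈ A i ↔ x ∈ B)) :
    Tendsto (fun i => ∫ x in A i, f x ∂μ) l (𝓝 (∫ x in B, f x ∂μ)) := by
  simp_rw [← integral_indicator (hA _), ← integral_indicator hB]
  refine tendsto_integral_filter_of_dominated_convergence (fun x => ‖f x‖)
    (.of_forall fun i => hf.aestronglyMeasurable.indicator (hA i))
    (.of_forall fun i => .of_forall fun x => norm_indicator_le_norm_self _ _) hf.norm ?_
  filter_upwards [h] with x hx
  refine tendsto_const_nhds.congr' ?_
  filter_upwards [hx] with i hi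
  by_cases hxB : x ∈ B <;> simp [hi, hxB]

lemma lintegral_setLIntegral_swap {α β : Type*} [MeasurableSpace α] [MeasurableSpace β]
    {μ : Measure α} {ρ : Measure β} [SFinite μ] [SFinite ρ] {S : Set (α × β)}
    (hS : MeasurableSet S) {f : β → ℝ≥0∞} (hf : AEMeasurable f ρ) :
    ∫⁻ x, ∫⁻ y in {y | (x, y) ∈ S}, f y ∂ρ ∂μ = ∫⁻ y, μ {x | (x, y) ∈ S} * f y ∂ρ := by
  have h_left (x : α) : ∫⁻ y in {y | (x, y) ∈ S}, f y ∂ρ =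
      ∫⁻ y, S.indicator (fun p => f p.2) (x, y) ∂ρ :=
    (lintegral_indicator (measurable_prodMk_left hS) f).symm
  have h_right (y : β) : ∫⁻ x, S.indicator (fun p => f p.2) (x, y) ∂μ =
      μ {x | (x, y) ∈ S} * f y := by
    rw [mul_comm, ← setLIntegral_const]
    exact lintegral_indicator (measurable_prodMk_right hS) fun _ => f y
  simp_rw [h_left, ← h_right]
  exact lintegral_lintegral_swap (hf.comp_snd.indicator hS)

lemma integrable_indicator_Iio_uncurry {α E : Type*} [LinearOrder α] [TopologicalSpace α]
    [OrderClosedTopology α] [SecondCountableTopology α] [MeasurableSpace α]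
    [OpensMeasurableSpace α] [NormedAddCommGroup E] {μ : Measure α} [IsFiniteMeasure μ]
    {f : α → E} (hf : Integrable f μ) :
    Integrable (Function.uncurry fun s u => (Iio s).indicator f u) (μ.prod μ) :=
  (hf.comp_snd μ).indicator (measurableSet_lt measurable_snd measurable_fst)

lemma integrable_setIntegral_Iio {α E : Type*} [LinearOrder α] [TopologicalSpace α]
    [OrderClosedTopology α] [SecondCountableTopology α] [MeasurableSpace α]
    [OpensMeasurableSpace α] [NormedAddCommGroup E] [NormedSpace ℝ E] {μ : Measure α}
    [IsFiniteMeasure μ] {f : α → E} (hf : Integrable f μ) :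
    Integrable (fun s => ∫ u in Iio s, f u ∂μ) μ := by
  simpa only [Function.uncurry, integral_indicator measurableSet_Iio] using
    (integrable_indicator_Iio_uncurry hf).integral_prod_left

lemma integral_setIntegral_Iio {α E : Type*} [LinearOrder α] [TopologicalSpace α]
    [OrderClosedTopology α] [SecondCountableTopology α] [MeasurableSpace α]
    [OpensMeasurableSpace α] [NormedAddCommGroup E] [NormedSpace ℝ E] [CompleteSpace E]
    {μ : Measure α} [IsFiniteMeasure μ] {f : α → E} (hf : Integrable f μ) :
    ∫ s, ∫ u in Iio s, f u ∂μ ∂μ = ∫ u, μ.real (Ioi u) • f u ∂μ := by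
  have h_right (u : α) : ∫ s, (Iio s).indicator f u ∂μ = μ.real (Ioi u) • f u := by
    rw [← setIntegral_const]
    exact integral_indicator (f := fun _ => f u) measurableSet_Ioi
  simp_rw [← integral_indicator measurableSet_Iio, ← h_right]
  exact integral_integral_swap (integrable_indicator_Iio_uncurry hf)

lemma eVariationOn_le_measure {α E : Type*} [LinearOrder α] [TopologicalSpace α]
    [OrderClosedTopology α] [MeasurableSpace α] [OpensMeasurableSpace α] [PseudoEMetricSpace E]
    {f : α → E} {μ : Measure α} (h : ∀ s t, s ≤ t → edist (f t) (f s) ≤ μ (Ioc s t)) :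
    eVariationOn f univ ≤ μ univ := by
  refine iSup_le fun ⟨n, u, hu, _⟩ => ?_
  calc ∑ i ∈ Finset.range n, edist (f (u (i + 1))) (f (u i))
      ≤ ∑ i ∈ Finset.range n, μ (Ioc (u i) (u (i + 1))) :=
        Finset.sum_le_sum fun i _ => h _ _ (hu i.le_succ)
    _ = μ (⋃ i ∈ Finset.range n, Ioc (u i) (u (i + 1))) :=
        (measure_biUnion_finset (hu.pairwise_disjoint_on_Ioc_succ.set_pairwise _)
          fun _ _ => measurableSet_Ioc).symm
    _ ≤ μ univ := measure_mono (subset_univ _)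

section Jump

variable {E : Type*} [NormedAddCommGroup E] {μ : Measure ℝ≥0} {F f : ℝ≥0 → E} {c : E} {g : ℝ≥0∞}

lemma enorm_le_of_enorm_sub_le_measure
    (hF : ∀ s t : ℝ≥0, s ≤ t → (t : ℝ≥0∞) < g → ‖F t - F s‖ₑ ≤ μ (Ioc s t)) {s : ℝ≥0}
    (hs : (s : ℝ≥0∞) < g) : ‖F s‖ₑ ≤ ‖F 0‖ₑ + μ {u | (u : ℝ≥0∞) < g} :=
  calc ‖F s‖ₑ = ‖F 0 + (F s - F 0)‖ₑ := by rw [add_sub_cancel]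
    _ ≤ ‖F 0‖ₑ + ‖F s - F 0‖ₑ := enorm_add_le _ _
    _ ≤ ‖F 0‖ₑ + μ {u | (u : ℝ≥0∞) < g} := by
      gcongr
      exact (hF 0 s zero_le hs).trans
        (measure_mono fun u hu => (ENNReal.coe_le_coe.2 hu.2).trans_lt hs)

lemma enorm_sub_le_measure_of_jump
    (hF : ∀ s t : ℝ≥0, s ≤ t → (t : ℝ≥0∞) < g → ‖F t - F s‖ₑ ≤ μ (Ioc s t))
    (h_before : ∀ t : ℝ≥0, (t : ℝ≥0∞) < g → f t = F t)
    (h_after : ∀ t : ℝ≥0, g ≤ (t : ℝ≥0∞) → f t = c) {s t : ℝ≥0} (hst : s ≤ t) :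
    ‖f t - f s‖ₑ ≤ (μ.restrict {u | (u : ℝ≥0∞) < g} +
      (‖F 0‖ₑ + ‖c‖ₑ + μ {u | (u : ℝ≥0∞) < g}) • Measure.dirac g.toNNReal) (Ioc s t) := by
  rcases lt_or_ge (t : ℝ≥0∞) g with ht | ht
  · have h_restrict : μ (Ioc s t) = μ.restrict {u | (u : ℝ≥0∞) < g} (Ioc s t) := by
      rw [Measure.restrict_apply measurableSet_Ioc, inter_eq_left.2]
      exact fun u hu => (ENNReal.coe_le_coe.2 hu.2).trans_lt ht
    rw [h_before t ht, h_before s ((ENNReal.coe_le_coe.2 hst).trans_lt ht)]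
    exact (hF s t hst ht).trans (h_restrict ▸ le_self_add)
  rcases lt_or_ge (s : ℝ≥0∞) g with hs | hs
  · have h_mem : g.toNNReal ∈ Ioc s t := by
      lift g to ℝ≥0 using (ht.trans_lt ENNReal.coe_lt_top).ne
      exact ⟨ENNReal.coe_lt_coe.1 hs, ENNReal.coe_le_coe.1 ht⟩
    rw [h_after t ht, h_before s hs]
    calc ‖c - F s‖ₑ ≤ ‖c‖ₑ + ‖F s‖ₑ := enorm_sub_le
      _ ≤ ‖c‖ₑ + (‖F 0‖ₑ + μ {u | (u : ℝ≥0∞) < g}) := by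
        gcongr; exact enorm_le_of_enorm_sub_le_measure hF hs
      _ = ‖F 0‖ₑ + ‖c‖ₑ + μ {u | (u : ℝ≥0∞) < g} := by ring
      _ ≤ _ := by simp [indicator_of_mem h_mem]
  · simp [h_after t ht, h_after s hs]

lemma enorm_add_eVariationOn_le_of_jump
    (hF : ∀ s t : ℝ≥0, s ≤ t → (t : ℝ≥0∞) < g → ‖F t - F s‖ₑ ≤ μ (Ioc s t))
    (h_before : ∀ t : ℝ≥0, (t : ℝ≥0∞) < g → f t = F t)
    (h_after : ∀ t : ℝ≥0, g ≤ (t : ℝ≥0∞) → f t = c) :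
    ‖f 0‖ₑ + eVariationOn f univ ≤ 2 * (‖F 0‖ₑ + ‖c‖ₑ + μ {u | (u : ℝ≥0∞) < g}) := by
  set V := μ {u : ℝ≥0 | (u : ℝ≥0∞) < g}
  have h_zero : ‖f 0‖ₑ ≤ ‖F 0‖ₑ + ‖c‖ₑ := by
    rcases lt_or_ge ((0 : ℝ≥0) : ℝ≥0∞) g with h | h
    · exact h_before 0 h ▸ le_self_add
    · exact h_after 0 h ▸ le_add_self
  have h_var : eVariationOn f univ ≤ V + (‖F 0‖ₑ + ‖c‖ₑ + V) := by
    refine (eVariationOn_le_measure fun s t hst => ?_).trans_eq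
      (b := (μ.restrict {u | (u : ℝ≥0∞) < g} +
        (‖F 0‖ₑ + ‖c‖ₑ + V) • Measure.dirac g.toNNReal) univ) (by simp [V])
    rw [edist_eq_enorm_sub]
    exact enorm_sub_le_measure_of_jump hF h_before h_after hst
  calc ‖f 0‖ₑ + eVariationOn f univ
      ≤ (‖F 0‖ₑ + ‖c‖ₑ) + (V + (‖F 0‖ₑ + ‖c‖ₑ + V)) := add_le_add h_zero h_var
    _ = 2 * (‖F 0‖ₑ + ‖c‖ₑ + V) := by ring

end Jump

lemma tsum_enorm_sub_lt_top_of_antitone {u : ℕ → ℝ} (hu : Antitone u) (h_nonneg : ∀ n, 0 ≤ u n) :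
    ∑' n, ‖u n - u (n - 1)‖ₑ < ∞ := by
  have h_sum (n : ℕ) :
      ∑ k ∈ Finset.range (n + 1), ‖u k - u (k - 1)‖ₑ = ENNReal.ofReal (u 0 - u n) := by
    induction n with
    | zero => simp
    | succ n ih =>
      rw [Finset.sum_range_succ, ih, enorm_sub_rev, Nat.add_sub_cancel,
        Real.enorm_of_nonneg (sub_nonneg.2 (hu n.le_succ)),
        ← ENNReal.ofReal_add (sub_nonneg.2 (hu n.zero_le)) (sub_nonneg.2 (hu n.le_succ)),
        sub_add_sub_cancel]
  refine (ENNReal.tsum_le_of_sum_range_le fun n => ?_).trans_lt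
    (ENNReal.ofReal_lt_top (r := u 0))
  calc ∑ k ∈ Finset.range n, ‖u k - u (k - 1)‖ₑ
      ≤ ∑ k ∈ Finset.range (n + 1), ‖u k - u (k - 1)‖ₑ :=
        Finset.sum_le_sum_of_subset (Finset.range_mono n.le_succ)
    _ = ENNReal.ofReal (u 0 - u n) := h_sum n
    _ ≤ ENNReal.ofReal (u 0) := ENNReal.ofReal_le_ofReal (sub_le_self _ (h_nonneg n))

section StepFunction

variable {R : Type*} [Semiring R] [LinearOrder R] [IsStrictOrderedRing R] [FloorSemiring R]
  [TopologicalSpace R] [OrderTopology R]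

lemma eventually_floor_eq (t : R) : ∀ᶠ s in 𝓝[≥] t, ⌊s⌋₊ = ⌊t⌋₊ := by
  filter_upwards [self_mem_nhdsWithin,
    mem_nhdsWithin_of_mem_nhds (Iio_mem_nhds (Nat.lt_floor_add_one t))] with s hts hs
  have h_lt : ⌊s⌋₊ < ⌊t⌋₊ + 1 :=
    (Nat.floor_lt' (Nat.succ_ne_zero _)).2 (by simpa only [Nat.cast_succ, mem_Iio] using hs)
  exact le_antisymm (Nat.lt_succ_iff.1 h_lt) (Nat.floor_mono hts)

lemma eventually_floor_eq_ceil_sub_one (t : R) : ∀ᶠ s in 𝓝[<] t, ⌊s⌋₊ = ⌈t⌉₊ - 1 := by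
  rcases Nat.eq_zero_or_pos ⌈t⌉₊ with h | h
  · filter_upwards [self_mem_nhdsWithin] with s hs
    rw [h, Nat.floor_of_nonpos ((le_of_lt hs).trans (Nat.ceil_eq_zero.1 h))]
  · have h_lt : ((⌈t⌉₊ - 1 : ℕ) : R) < t := Nat.lt_ceil.1 (Nat.sub_lt h one_pos)
    filter_upwards [self_mem_nhdsWithin, mem_nhdsWithin_of_mem_nhds (Ioi_mem_nhds h_lt)]
      with s hst hs
    have h_floor : ⌊s⌋₊ < ⌈t⌉₊ := (Nat.floor_lt' h.ne').2 (hst.trans_le (Nat.le_ceil t))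
    exact le_antisymm (Nat.le_sub_one_of_lt h_floor) (Nat.le_floor (le_of_lt hs))

end StepFunction

/-! ### The law of the jump time -/

section Law

variable {ν : Measure ℝ≥0∞} {s t : ℝ≥0}

lemma measurableEmbedding_ennreal_coe : MeasurableEmbedding ((↑) : ℝ≥0 → ℝ≥0∞) :=
  ENNReal.isOpenEmbedding_coe.measurableEmbedding

lemma dG_apply (ν : Measure ℝ≥0∞) (s : Set ℝ≥0) : dG ν s = ν ((↑) '' s) :=
  measurableEmbedding_ennreal_coe.comap_apply _ _

lemma dG_eq_map (ν : Measure ℝ≥0∞) : dG ν = (ν.restrict (Iio ∞)).map ENNReal.toNNReal := by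
  ext s hs
  rw [dG_apply, Measure.map_apply ENNReal.measurable_toNNReal hs,
    Measure.restrict_apply (ENNReal.measurable_toNNReal hs)]
  congr 1
  ext x
  induction x <;> simp

instance [IsFiniteMeasure ν] : IsFiniteMeasure (dG ν) := by
  rw [dG_eq_map]; infer_instance

lemma exists_gt_measure_Ioi_pos (h : 0 < ν (Ioi (t : ℝ≥0∞))) :
    ∃ s, t < s ∧ 0 < ν (Ioi (s : ℝ≥0∞)) := by
  obtain ⟨u, -, h_gt, h_lim⟩ := exists_seq_strictAnti_tendsto t
  have h_cover : Ioi (t : ℝ≥0∞) ⊆ ⋃ n, Ioi (u n : ℝ≥0∞) := fun x hx =>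
    mem_iUnion.2 ((ENNReal.tendsto_coe.2 h_lim).eventually_lt_const hx).exists
  obtain ⟨n, hn⟩ := exists_measure_pos_of_not_measure_iUnion_null
    (h.trans_le (measure_mono h_cover)).ne'
  exact ⟨u n, h_gt n, hn⟩

lemma mem_beforeEnd_of_le (h : s ≤ t) (ht : t ∈ beforeEnd ν) : s ∈ beforeEnd ν :=
  (ENNReal.coe_le_coe.2 h).trans_lt ht

lemma measurableSet_beforeEnd : MeasurableSet (beforeEnd ν) :=
  measurableSet_lt measurable_coe_nnreal_ennreal measurable_const

lemma endpoint_eq_top (h : beforeEnd ν = univ) : endpoint ν = ∞ := by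
  by_contra h_ne
  exact (ne_of_lt (h ▸ mem_univ (endpoint ν).toNNReal : _ ∈ beforeEnd ν))
    (ENNReal.coe_toNNReal h_ne)

lemma measurableSet_timeSet : MeasurableSet (timeSet ν) := by
  have h_lower : IsLowerSet (timeSet ν) := fun _ _ h ht =>
    ht.trans_le (measure_mono (Ici_subset_Ici.2 (ENNReal.coe_le_coe.2 h)))
  exact h_lower.ordConnected.measurableSet

lemma eventually_toEnd_mem : ∀ᶠ t in toEnd ν, t ∈ beforeEnd ν :=
  preimage_mem_comap self_mem_nhdsWithin

lemma eventually_toEnd_ge (hs : s ∈ beforeEnd ν) : ∀ᶠ t in toEnd ν, s ≤ t := by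
  have h : ∀ᶠ x in 𝓝[<] (endpoint ν), (s : ℝ≥0∞) < x :=
    mem_nhdsWithin_of_mem_nhds (lt_mem_nhds hs)
  filter_upwards [preimage_mem_comap h] with t ht
  exact (ENNReal.coe_lt_coe.1 ht).le

instance : (toEnd ν).IsCountablyGenerated := by
  rw [toEnd]; infer_instance

lemma atTop_le_toEnd (h : beforeEnd ν = univ) : atTop ≤ toEnd ν := by
  rw [toEnd, endpoint_eq_top h, ← tendsto_iff_comap]
  exact tendsto_nhdsWithin_iff.2 ⟨ENNReal.tendsto_coe_nhds_top.2 tendsto_id,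
    .of_forall fun t => ENNReal.coe_lt_top⟩

lemma caseA_of_beforeEnd_eq_univ (h : beforeEnd ν = univ) : CaseA ν := by
  have h_empty : {x : ℝ≥0∞ | x = endpoint ν ∧ x < ∞} = ∅ :=
    eq_empty_of_forall_notMem fun x hx => hx.2.ne (hx.1.trans (endpoint_eq_top h))
  rw [CaseA, h_empty, measure_empty]

lemma CaseB.endpoint_lt_top (hB : CaseB ν) : endpoint ν < ∞ := by
  obtain ⟨x, rfl, hx⟩ := nonempty_of_measure_ne_zero hB.ne'
  exact hx

lemma CaseB.mem_timeSet (hB : CaseB ν) (ht : (t : ℝ≥0∞) ≤ endpoint ν) : t ∈ timeSet ν :=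
  hB.trans_le (measure_mono fun _ hx => hx.1 ▸ ht)

variable [IsProbabilityMeasure ν]

lemma tailG_eq (t : ℝ≥0) : tailG ν t = ν.real (Ioi (t : ℝ≥0∞)) := by
  rw [tailG, cdfG, ← compl_Iic, probReal_compl_eq_one_sub measurableSet_Iic]

lemma ofReal_tailG (t : ℝ≥0) : ENNReal.ofReal (tailG ν t) = ν (Ioi (t : ℝ≥0∞)) := by
  rw [tailG_eq, ofReal_measureReal]

lemma tailG_nonneg (t : ℝ≥0) : 0 ≤ tailG ν t := by
  rw [tailG_eq]; positivity

lemma tailG_le_one (t : ℝ≥0) : tailG ν t ≤ 1 := by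
  rw [tailG_eq]; exact measureReal_le_one

lemma tailG_antitone : Antitone (tailG ν) := by
  intro s t h
  rw [tailG_eq, tailG_eq]
  exact measureReal_mono (Ioi_subset_Ioi (ENNReal.coe_le_coe.2 h))

lemma tailG_pos_iff : 0 < tailG ν t ↔ 0 < ν (Ioi (t : ℝ≥0∞)) := by
  rw [← ofReal_tailG, ENNReal.ofReal_pos]

lemma mem_beforeEnd_iff : t ∈ beforeEnd ν ↔ 0 < tailG ν t := by
  refine ⟨fun h => ?_, fun h => ?_⟩
  · obtain ⟨_, ⟨s, hs, rfl⟩, hts⟩ := lt_sSup_iff.1 (show (t : ℝ≥0∞) < endpoint ν from h)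
    exact (sub_pos.2 hs).trans_le (tailG_antitone (ENNReal.coe_lt_coe.1 hts).le)
  · obtain ⟨s, hts, hs⟩ := exists_gt_measure_Ioi_pos (tailG_pos_iff.1 h)
    exact (ENNReal.coe_lt_coe.2 hts).trans_le
      (le_sSup ⟨s, sub_pos.1 (tailG_pos_iff.2 hs), rfl⟩)

lemma tailG_eq_zero (ht : t ∉ beforeEnd ν) : tailG ν t = 0 :=
  le_antisymm (not_lt.1 fun h => ht (mem_beforeEnd_iff.2 h)) (tailG_nonneg t)

lemma beforeEnd_subset_timeSet : beforeEnd ν ⊆ timeSet ν := fun _ ht =>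
  (tailG_pos_iff.1 (mem_beforeEnd_iff.1 ht)).trans_le (measure_mono Ioi_subset_Ici_self)

lemma ae_le_endpoint : ∀ᵐ x ∂ν, x ≤ endpoint ν := by
  rcases eq_or_ne (endpoint ν) ∞ with h | h
  · simp [h]
  have h_notMem : (endpoint ν).toNNReal ∉ beforeEnd ν := by
    simp [beforeEnd, ENNReal.coe_toNNReal h]
  have h_null := ofReal_tailG (ν := ν) (endpoint ν).toNNReal
  rw [tailG_eq_zero h_notMem, ENNReal.ofReal_zero, ENNReal.coe_toNNReal h] at h_null
  filter_upwards [compl_mem_ae_iff.2 h_null.symm] with x hx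
  exact not_lt.1 hx

lemma ae_lt_endpoint (hA : CaseA ν) : ∀ᵐ x ∂ν, x < ∞ → x < endpoint ν := by
  filter_upwards [ae_le_endpoint, compl_mem_ae_iff.2 hA] with x hx h_atom hx_top
  exact hx.lt_of_ne fun h => h_atom ⟨h, hx_top⟩

lemma ae_dG_coe_le_endpoint : ∀ᵐ s : ℝ≥0 ∂dG ν, (s : ℝ≥0∞) ≤ endpoint ν := by
  rw [dG_eq_map, ae_map_iff ENNReal.measurable_toNNReal.aemeasurable
    (measurableSet_le measurable_coe_nnreal_ennreal measurable_const),
    ae_restrict_iff' measurableSet_Iio]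
  filter_upwards [ae_le_endpoint (ν := ν)] with x hx h_top
  rwa [ENNReal.coe_toNNReal (mem_Iio.1 h_top).ne]

lemma ae_dG_mem_beforeEnd (hA : CaseA ν) : ∀ᵐ s ∂dG ν, s ∈ beforeEnd ν := by
  rw [dG_eq_map]
  refine (ae_map_iff ENNReal.measurable_toNNReal.aemeasurable measurableSet_beforeEnd).2 ?_
  rw [ae_restrict_iff' measurableSet_Iio]
  filter_upwards [ae_lt_endpoint hA] with x hx h_top
  simpa [beforeEnd, ENNReal.coe_toNNReal (mem_Iio.1 h_top).ne] using hx h_top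

lemma ae_dG_mem_timeSet : ∀ᵐ s ∂dG ν, s ∈ timeSet ν := by
  by_cases hA : CaseA ν
  · filter_upwards [ae_dG_mem_beforeEnd hA] with s hs using beforeEnd_subset_timeSet hs
  · filter_upwards [ae_dG_coe_le_endpoint] with s hs
    exact CaseB.mem_timeSet (pos_iff_ne_zero.2 hA) hs

lemma restrict_beforeEnd (hA : CaseA ν) : (dG ν).restrict (beforeEnd ν) = dG ν :=
  Measure.restrict_eq_self_of_ae_mem (ae_dG_mem_beforeEnd hA)

lemma dG_real_Ioc (h : s ≤ t) : (dG ν).real (Ioc s t) = tailG ν s - tailG ν t := by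
  rw [tailG_eq, tailG_eq, Measure.real, dG_apply, ENNReal.image_coe_Ioc, ← Ioi_sdiff_Ioi,
    ← Measure.real, measureReal_sdiff (Ioi_subset_Ioi (ENNReal.coe_le_coe.2 h)) measurableSet_Ioi]

end Law

section Random

variable {Ω : Type*} [MeasurableSpace Ω] {P : Measure Ω} {γ : Ω → ℝ≥0∞}

lemma tailG_map [IsProbabilityMeasure P] (hγ : Measurable γ) (t : ℝ≥0) :
    tailG (P.map γ) t = P.real {ω | (t : ℝ≥0∞) < γ ω} := by
  have := Measure.isProbabilityMeasure_map (μ := P) hγ.aemeasurable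
  rw [tailG_eq, map_measureReal_apply hγ measurableSet_Ioi]
  rfl

lemma dG_map (hγ : Measurable γ) :
    dG (P.map γ) = (P.restrict {ω | γ ω < ∞}).map (fun ω => (γ ω).toNNReal) := by
  rw [dG_eq_map, Measure.restrict_map hγ measurableSet_Iio,
    Measure.map_map ENNReal.measurable_toNNReal hγ]
  rfl

lemma restrict_dG_map (hγ : Measurable γ) {s : Set ℝ≥0} (hs : MeasurableSet s) :
    (dG (P.map γ)).restrict s =
      (P.restrict (γ ⁻¹' ((↑) '' s))).map (fun ω => (γ ω).toNNReal) := by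
  rw [dG_map hγ, Measure.restrict_map hγ.ennreal_toNNReal hs,
    Measure.restrict_restrict (hγ.ennreal_toNNReal hs)]
  congr 2
  ext ω
  simp only [mem_inter_iff, mem_preimage, mem_ofPred_eq]
  induction γ ω <;> simp

lemma lintegral_dG_map (hγ : Measurable γ) {f : ℝ≥0 → ℝ≥0∞}
    (hf : AEMeasurable f (dG (P.map γ))) :
    ∫⁻ s, f s ∂(dG (P.map γ)) = ∫⁻ ω in {ω | γ ω < ∞}, f (γ ω).toNNReal ∂P := by
  rw [dG_map hγ] at hf ⊢
  exact lintegral_map' hf hγ.ennreal_toNNReal.aemeasurable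

lemma setIntegral_dG_map (hγ : Measurable γ) {f : ℝ≥0 → ℝ} {s : Set ℝ≥0} (hs : MeasurableSet s)
    (hf : AEStronglyMeasurable f (dG (P.map γ))) :
    ∫ x in s, f x ∂(dG (P.map γ)) = ∫ ω in γ ⁻¹' ((↑) '' s), f (γ ω).toNNReal ∂P := by
  have hf' := hf.restrict (s := s)
  rw [restrict_dG_map hγ hs] at hf' ⊢
  exact integral_map hγ.ennreal_toNNReal.aemeasurable hf'

lemma integrableOn_dG_map (hγ : Measurable γ) {f : ℝ≥0 → ℝ} {s : Set ℝ≥0} (hs : MeasurableSet s)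
    (hf : AEStronglyMeasurable f (dG (P.map γ))) :
    IntegrableOn f s (dG (P.map γ)) ↔
      IntegrableOn (fun ω => f (γ ω).toNNReal) (γ ⁻¹' ((↑) '' s)) P := by
  have hf' := hf.restrict (s := s)
  rw [IntegrableOn]
  rw [restrict_dG_map hγ hs] at hf' ⊢
  exact integrable_map_measure hf' hγ.ennreal_toNNReal.aemeasurable

end Random

/-! ### Condition M -/

section ConditionM

variable {ν : Measure ℝ≥0∞} {F H z : ℝ≥0 → ℝ} {s t : ℝ≥0}

/-- The left limit `F(s-)` of a function with density `z = dF/dG`, written as an integral so that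
it is defined for every `s`. -/
noncomputable def leftValue (ν : Measure ℝ≥0∞) (F z : ℝ≥0 → ℝ) (s : ℝ≥0) : ℝ :=
  F 0 + ∫ u in Ioo 0 s, z u ∂(dG ν)

/-- The limit of `F(t)(1 - G(t))` as `t ↑ t_G`, read off from Condition M; the type of the local
martingale is governed by its sign. -/
noncomputable def endMass (ν : Measure ℝ≥0∞) (F H : ℝ≥0 → ℝ) : ℝ :=
  F 0 * tailG ν 0 - ∫ s in beforeEnd ν ∩ Ioi 0, H s ∂(dG ν)

lemma ConditionM.tendsto_endMass (hM : ConditionM ν F H)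
    (hH : IntegrableOn H (beforeEnd ν) (dG ν)) :
    Tendsto (fun t => F t * tailG ν t) (toEnd ν) (𝓝 (endMass ν F H)) := by
  have h_lim : Tendsto (fun t => ∫ s in Ioc 0 t, H s ∂((dG ν).restrict (beforeEnd ν))) (toEnd ν)
      (𝓝 (∫ s in Ioi 0, H s ∂((dG ν).restrict (beforeEnd ν)))) := by
    refine tendsto_setIntegral_of_eventually_mem_iff hH (fun _ => measurableSet_Ioc)
      measurableSet_Ioi ?_
    filter_upwards [ae_restrict_mem measurableSet_beforeEnd] with s hs
    filter_upwards [eventually_toEnd_ge hs] with t ht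
    simp [ht]
  rw [Measure.restrict_restrict measurableSet_Ioi, inter_comm] at h_lim
  refine (tendsto_const_nhds.sub h_lim).congr' ?_
  filter_upwards [eventually_toEnd_mem] with t ht
  rw [Measure.restrict_restrict measurableSet_Ioc,
    inter_eq_left.2 fun s hs => mem_beforeEnd_of_le hs.2 ht, ← hM.main t ht, add_sub_cancel_right]

lemma ConditionM.mul_tailG_eq (hM : ConditionM ν F H) (hH : IntegrableOn H (beforeEnd ν) (dG ν))
    (ht : t ∈ beforeEnd ν) :
    F t * tailG ν t = endMass ν F H + ∫ s in beforeEnd ν ∩ Ioi t, H s ∂(dG ν) := by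
  have h_union : beforeEnd ν ∩ Ioi 0 = Ioc 0 t ∪ (beforeEnd ν ∩ Ioi t) := by
    rw [← Ioc_union_Ioi_eq_Ioi (zero_le : 0 ≤ t), inter_union_distrib_left,
      inter_eq_right.2 fun s hs => mem_beforeEnd_of_le hs.2 ht]
  have h_disj : Disjoint (Ioc 0 t) (beforeEnd ν ∩ Ioi t) :=
    disjoint_left.2 fun s hs hs' => not_lt.2 hs.2 hs'.2
  rw [endMass, h_union, setIntegral_union h_disj (measurableSet_beforeEnd.inter measurableSet_Ioi)
    (hH.mono_set fun s hs => mem_beforeEnd_of_le hs.2 ht) (hH.mono_set inter_subset_left),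
    ← hM.main t ht]
  ring

lemma setIntegral_Iio_restrict_Ioc (hs : s ∈ Ioc 0 t) :
    ∫ u in Iio s, z u ∂((dG ν).restrict (Ioc 0 t)) = ∫ u in Ioo 0 s, z u ∂(dG ν) := by
  rw [Measure.restrict_restrict measurableSet_Iio]
  congr 2
  ext u
  simp only [mem_inter_iff, mem_Iio, mem_Ioc, mem_Ioo]
  exact ⟨fun h => ⟨h.2.1, h.1⟩, fun h => ⟨h.2, h.1, h.2.le.trans hs.2⟩⟩

variable [IsProbabilityMeasure ν]

lemma MemL1loc.aestronglyMeasurable (hz : MemL1loc ν z) : AEStronglyMeasurable z (dG ν) := by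
  rw [← Measure.restrict_eq_self_of_ae_mem (ae_dG_mem_timeSet (ν := ν))]
  exact (aemeasurable_restrict_of_measurable_subtype measurableSet_timeSet
    hz.1).aestronglyMeasurable

lemma MemL1loc.integrableOn_Iic (hz : MemL1loc ν z) (ht : t ∈ beforeEnd ν) :
    IntegrableOn z (Iic t) (dG ν) := hz.2 t (beforeEnd_subset_timeSet ht)

lemma MemL1loc.integrable_of_caseB (hz : MemL1loc ν z) (hB : CaseB ν) : Integrable z (dG ν) := by
  have h_coe := ENNReal.coe_toNNReal hB.endpoint_lt_top.ne
  have h_mem : ∀ᵐ s ∂dG ν, s ∈ Iic (endpoint ν).toNNReal := by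
    filter_upwards [ae_dG_coe_le_endpoint (ν := ν)] with s hs
    exact ENNReal.coe_le_coe.1 (hs.trans h_coe.ge)
  rw [← Measure.restrict_eq_self_of_ae_mem h_mem]
  exact hz.2 _ (hB.mem_timeSet h_coe.le)

lemma IsDensity.sub_eq_setIntegral (hF : IsDensity ν F z) (hst : s ≤ t) (ht : t ∈ beforeEnd ν) :
    F t - F s = ∫ u in Ioc s t, z u ∂(dG ν) := by
  have hz := hF.1.integrableOn_Iic ht
  rw [hF.2 t ht, hF.2 s (mem_beforeEnd_of_le hst ht), ← Ioc_union_Ioc_eq_Ioc zero_le hst,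
    setIntegral_union (Ioc_disjoint_Ioc_of_le le_rfl) measurableSet_Ioc
      (hz.mono_set fun u hu => hu.2.trans hst) (hz.mono_set fun u hu => hu.2)]
  ring

lemma IsDensity.tendsto_leftValue (hF : IsDensity ν F z) (hs : s ∈ beforeEnd ν) :
    Tendsto F (𝓝[<] s) (𝓝 (leftValue ν F z s)) := by
  have h_lim : Tendsto (fun t => ∫ u in Ioc 0 t, z u ∂((dG ν).restrict (Iic s))) (𝓝[<] s)
      (𝓝 (∫ u in Ioo 0 s, z u ∂((dG ν).restrict (Iic s)))) := by
    refine tendsto_setIntegral_of_eventually_mem_iff (hF.1.integrableOn_Iic hs)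
      (fun _ => measurableSet_Ioc) measurableSet_Ioo (.of_forall fun u => ?_)
    rcases lt_or_ge u s with hu | hu
    · filter_upwards [mem_nhdsWithin_of_mem_nhds (lt_mem_nhds hu)] with t ht
      simp [hu, le_of_lt (show u < t from ht)]
    · filter_upwards [self_mem_nhdsWithin] with t ht
      simp [hu.not_gt, ((mem_Iio.1 ht).trans_le hu).not_ge]
  rw [Measure.restrict_restrict_of_subset (Ioo_subset_Iio_self.trans Iio_subset_Iic_self)] at h_lim
  refine (h_lim.const_add (F 0)).congr' ?_
  filter_upwards [self_mem_nhdsWithin] with t ht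
  rw [Measure.restrict_restrict_of_subset fun u hu => hu.2.trans (le_of_lt ht),
    hF.2 t (mem_beforeEnd_of_le (le_of_lt ht) hs)]

lemma integrableOn_tailG_mul (hz : IntegrableOn z (Iic t) (dG ν)) :
    IntegrableOn (fun s => tailG ν s * z s) (Iic t) (dG ν) := by
  refine Integrable.bdd_mul (c := 1) hz tailG_antitone.measurable.aestronglyMeasurable
    (.of_forall fun s => ?_)
  rw [Real.norm_eq_abs, abs_of_nonneg (tailG_nonneg s)]
  exact tailG_le_one s

lemma integrableOn_setIntegral_Ioo (hz : IntegrableOn z (Ioc 0 t) (dG ν)) :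
    IntegrableOn (fun s => ∫ u in Ioo 0 s, z u ∂(dG ν)) (Ioc 0 t) (dG ν) := by
  refine (integrable_setIntegral_Iio hz).congr ?_
  filter_upwards [ae_restrict_mem measurableSet_Ioc] with s hs
  exact setIntegral_Iio_restrict_Ioc hs

lemma setIntegral_setIntegral_Ioo (hz : IntegrableOn z (Ioc 0 t) (dG ν)) :
    ∫ s in Ioc 0 t, (∫ u in Ioo 0 s, z u ∂(dG ν)) ∂(dG ν) =
      ∫ u in Ioc 0 t, (tailG ν u - tailG ν t) * z u ∂(dG ν) := by
  rw [← setIntegral_congr_fun measurableSet_Ioc fun s hs => setIntegral_Iio_restrict_Ioc hs,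
    integral_setIntegral_Iio hz]
  refine setIntegral_congr_fun measurableSet_Ioc fun u hu => ?_
  have h_Ioc : Ioi u ∩ Ioc 0 t = Ioc u t := by
    rw [inter_comm, Ioc_inter_Ioi, sup_eq_right.2 hu.1.le]
  simp only [smul_eq_mul]
  rw [measureReal_restrict_apply measurableSet_Ioi, h_Ioc, dG_real_Ioc hu.2]

lemma IsDensity.integrableOn_leftValue (hF : IsDensity ν F z) (ht : t ∈ beforeEnd ν) :
    IntegrableOn (leftValue ν F z) (Ioc 0 t) (dG ν) :=
  (integrable_const (F 0)).add
    (integrableOn_setIntegral_Ioo ((hF.1.integrableOn_Iic ht).mono_set fun _ hu => hu.2))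

/-- Integration by parts, `d(F(1 - G)) = (1 - G) dF - F_- dG`. -/
lemma IsDensity.mul_tailG_eq (hF : IsDensity ν F z) (ht : t ∈ beforeEnd ν) :
    F t * tailG ν t = F 0 * tailG ν 0 +
      (∫ s in Ioc 0 t, tailG ν s * z s ∂(dG ν) - ∫ s in Ioc 0 t, leftValue ν F z s ∂(dG ν)) := by
  have hz := hF.1.integrableOn_Iic ht
  have h_sub : Ioc 0 t ⊆ Iic t := fun u hu => hu.2
  have h_left : ∫ s in Ioc 0 t, leftValue ν F z s ∂(dG ν) = F 0 * (tailG ν 0 - tailG ν t) +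
      ∫ u in Ioc 0 t, (tailG ν u - tailG ν t) * z u ∂(dG ν) := by
    simp only [leftValue]
    rw [integral_add (integrable_const _) (integrableOn_setIntegral_Ioo (hz.mono_set h_sub)),
      setIntegral_setIntegral_Ioo (hz.mono_set h_sub), setIntegral_const, smul_eq_mul,
      dG_real_Ioc zero_le, mul_comm]
  have h_right : ∫ u in Ioc 0 t, (tailG ν u - tailG ν t) * z u ∂(dG ν) =
      ∫ u in Ioc 0 t, tailG ν u * z u ∂(dG ν) - tailG ν t * ∫ u in Ioc 0 t, z u ∂(dG ν) := by
    simp only [sub_mul]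
    rw [integral_sub ((integrableOn_tailG_mul hz).mono_set h_sub)
      ((hz.mono_set h_sub).const_mul _), integral_const_mul]
  rw [h_left, h_right, hF.2 t ht]
  ring

lemma IsDensity.leftValue_ae_eq_Ioc (hF : IsDensity ν F z) (hM : ConditionM ν F H)
    (ht : t ∈ beforeEnd ν) :
    ∀ᵐ s ∂((dG ν).restrict (Ioc 0 t)), leftValue ν F z s = tailG ν s * z s + H s := by
  have h_integrable {r : ℝ≥0} (hr : r ∈ beforeEnd ν) :
      IntegrableOn (fun s => tailG ν s * z s + H s) (Ioc 0 r) (dG ν) :=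
    ((integrableOn_tailG_mul (hF.1.integrableOn_Iic hr)).add
      (hM.memL1loc.integrableOn_Iic hr)).mono_set fun u hu => hu.2
  have h_integral {r : ℝ≥0} (hr : r ∈ beforeEnd ν) :
      ∫ s in Ioc 0 r, (leftValue ν F z s - (tailG ν s * z s + H s)) ∂(dG ν) = 0 := by
    have h_sub : Ioc 0 r ⊆ Iic r := fun u hu => hu.2
    rw [integral_sub (hF.integrableOn_leftValue hr) (h_integrable hr),
      integral_add ((integrableOn_tailG_mul (hF.1.integrableOn_Iic hr)).mono_set h_sub)
        ((hM.memL1loc.integrableOn_Iic hr).mono_set h_sub)]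
    linarith [hM.main r hr, hF.mul_tailG_eq hr]
  have h_zero := ae_eq_zero_of_forall_setIntegral_Iic
    ((hF.integrableOn_leftValue ht).sub (h_integrable ht)) fun r => by
      rw [Measure.restrict_restrict measurableSet_Iic, inter_comm, Ioc_inter_Iic]
      exact h_integral (mem_beforeEnd_of_le (min_le_left _ _) ht)
  filter_upwards [h_zero] with s hs using sub_eq_zero.1 hs

/-- Compare integration by parts with Condition M. -/
lemma IsDensity.leftValue_ae_eq (hF : IsDensity ν F z) (hM : ConditionM ν F H) :
    ∀ᵐ s ∂((dG ν).restrict (beforeEnd ν ∩ Ioi 0)), leftValue ν F z s = tailG ν s * z s + H s := by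
  rw [ae_restrict_iff' (measurableSet_beforeEnd.inter measurableSet_Ioi), ae_iff]
  refine measure_null_of_locally_null _ fun s hs => ?_
  obtain ⟨⟨hs, -⟩, -⟩ := Classical.not_imp.1 hs
  obtain ⟨t, hst, ht⟩ := ENNReal.lt_iff_exists_nnreal_btwn.1 hs
  refine ⟨_, inter_mem_nhdsWithin _ (Iic_mem_nhds (ENNReal.coe_lt_coe.1 hst)), ?_⟩
  have h_Ioc := hF.leftValue_ae_eq_Ioc hM ht
  rw [ae_restrict_iff' measurableSet_Ioc] at h_Ioc
  refine measure_mono_null (fun u hu => ?_) (ae_iff.1 h_Ioc)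
  obtain ⟨⟨-, hu0⟩, h_ne⟩ := Classical.not_imp.1 hu.1
  exact fun h => h_ne (h ⟨hu0, hu.2⟩)

lemma setLIntegral_beforeEnd_lt_top {f : ℝ≥0 → ℝ≥0∞} (hf : f 0 ≠ ∞)
    (h : ∫⁻ s in beforeEnd ν ∩ Ioi 0, f s ∂(dG ν) < ∞) :
    ∫⁻ s in beforeEnd ν, f s ∂(dG ν) < ∞ := by
  have h_sub : beforeEnd ν ⊆ (beforeEnd ν ∩ Ioi 0) ∪ {0} := fun s hs =>
    (eq_zero_or_pos s).symm.imp (fun h => ⟨hs, h⟩) id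
  refine (lintegral_mono_set h_sub).trans_lt ((lintegral_union_le _ _ _).trans_lt ?_)
  rw [lintegral_singleton]
  exact ENNReal.add_lt_top.2 ⟨h, ENNReal.mul_lt_top hf.lt_top (measure_lt_top _ _)⟩

lemma IsDensity.lintegral_tailG_mul_lt_top (hF : IsDensity ν F z) (hM : ConditionM ν F H)
    (hH : IntegrableOn H (beforeEnd ν) (dG ν))
    (hL : ∫⁻ s in beforeEnd ν ∩ Ioi 0, ‖leftValue ν F z s‖ₑ ∂(dG ν) < ∞) :
    ∫⁻ s in beforeEnd ν, ENNReal.ofReal (tailG ν s * |z s|) ∂(dG ν) < ∞ := by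
  refine setLIntegral_beforeEnd_lt_top ENNReal.ofReal_ne_top ?_
  have hH' := hH.mono_set (t := beforeEnd ν) (s := beforeEnd ν ∩ Ioi 0) inter_subset_left
  calc ∫⁻ s in beforeEnd ν ∩ Ioi 0, ENNReal.ofReal (tailG ν s * |z s|) ∂(dG ν)
      ≤ ∫⁻ s in beforeEnd ν ∩ Ioi 0, (‖leftValue ν F z s‖ₑ + ‖H s‖ₑ) ∂(dG ν) := by
        refine lintegral_mono_ae ?_
        filter_upwards [hF.leftValue_ae_eq hM] with s hs
        rw [← abs_of_nonneg (tailG_nonneg (ν := ν) s), ← abs_mul, ← Real.enorm_eq_ofReal_abs,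
          ← sub_eq_iff_eq_add.2 hs]
        exact enorm_sub_le
    _ < ∞ := by
        rw [lintegral_add_right' _ hH'.aestronglyMeasurable.enorm]
        exact ENNReal.add_lt_top.2 ⟨hL, hH'.2⟩

lemma ConditionM.abs_mul_tailG_le (hM : ConditionM ν F H)
    (hH : IntegrableOn H (beforeEnd ν) (dG ν)) (ht : t ∈ beforeEnd ν) :
    |F t| * tailG ν t ≤ |F 0| + ∫ s in beforeEnd ν, ‖H s‖ ∂(dG ν) := by
  have h_init : |F 0 * tailG ν 0| ≤ |F 0| := by
    rw [abs_mul, abs_of_nonneg (tailG_nonneg 0)]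
    exact mul_le_of_le_one_right (abs_nonneg _) (tailG_le_one 0)
  have h_int : |∫ s in Ioc 0 t, H s ∂(dG ν)| ≤ ∫ s in beforeEnd ν, ‖H s‖ ∂(dG ν) :=
    (norm_integral_le_integral_norm H).trans <| setIntegral_mono_set hH.norm
      (.of_forall fun s => norm_nonneg _)
      (LE.le.eventuallyLE fun s hs => mem_beforeEnd_of_le hs.2 ht)
  calc |F t| * tailG ν t = |F t * tailG ν t| := by rw [abs_mul, abs_of_nonneg (tailG_nonneg t)]
    _ = |F 0 * tailG ν 0 - ∫ s in Ioc 0 t, H s ∂(dG ν)| := by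
        rw [eq_sub_of_add_eq (hM.main t ht)]
    _ ≤ |F 0 * tailG ν 0| + |∫ s in Ioc 0 t, H s ∂(dG ν)| := abs_sub _ _
    _ ≤ |F 0| + ∫ s in beforeEnd ν, ‖H s‖ ∂(dG ν) := add_le_add h_init h_int

lemma IsDensity.lintegral_tailG_mul_lt_top_of_le_tailG (hF : IsDensity ν F z)
    (hM : ConditionM ν F H) (hH : IntegrableOn H (beforeEnd ν) (dG ν)) {c : ℝ} (hc : 0 < c)
    (h_tail : ∀ t ∈ beforeEnd ν, c ≤ tailG ν t) :
    ∫⁻ s in beforeEnd ν, ENNReal.ofReal (tailG ν s * |z s|) ∂(dG ν) < ∞ := by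
  refine hF.lintegral_tailG_mul_lt_top hM hH ?_
  set K : ℝ := (|F 0| + ∫ s in beforeEnd ν, ‖H s‖ ∂(dG ν)) / c
  have h_bound : ∀ t ∈ beforeEnd ν, |F t| ≤ K := fun t ht => by
    rw [le_div_iff₀ hc]
    exact (mul_le_mul_of_nonneg_left (h_tail t ht) (abs_nonneg _)).trans (hM.abs_mul_tailG_le hH ht)
  have h_left : ∀ s ∈ beforeEnd ν ∩ Ioi 0, ‖leftValue ν F z s‖ₑ ≤ ENNReal.ofReal K := by
    rintro s ⟨hs, hs0⟩
    have : (𝓝[<] s).NeBot := nhdsLT_neBot_of_exists_lt ⟨0, hs0⟩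
    rw [Real.enorm_eq_ofReal_abs]
    refine ENNReal.ofReal_le_ofReal (le_of_tendsto (hF.tendsto_leftValue hs).abs ?_)
    filter_upwards [self_mem_nhdsWithin] with t ht
    exact h_bound t (mem_beforeEnd_of_le (le_of_lt ht) hs)
  calc ∫⁻ s in beforeEnd ν ∩ Ioi 0, ‖leftValue ν F z s‖ₑ ∂(dG ν)
      ≤ ∫⁻ _ in beforeEnd ν ∩ Ioi 0, ENNReal.ofReal K ∂(dG ν) :=
        setLIntegral_mono measurable_const h_left
    _ < ∞ := by
        rw [setLIntegral_const]
        exact ENNReal.mul_lt_top ENNReal.ofReal_lt_top (measure_lt_top _ _)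

end ConditionM

/-! ### Processes frozen at the jump time -/

section FollowsUntil

lemma enorm_le_totalVar {Ω : Type*} (M : ℝ≥0 → Ω → ℝ) (t : ℝ≥0) (ω : Ω) :
    ‖M t ω‖ₑ ≤ totalVar M ω :=
  calc ‖M t ω‖ₑ = ‖M 0 ω + (M t ω - M 0 ω)‖ₑ := by rw [add_sub_cancel]
    _ ≤ ‖M 0 ω‖ₑ + edist (M t ω) (M 0 ω) := by
      rw [edist_eq_enorm_sub]
      exact enorm_add_le _ _
    _ ≤ totalVar M ω := by
      rw [totalVar]
      gcongr
      exact eVariationOn.edist_le (fun t => M t ω) (mem_univ t) (mem_univ 0)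

variable {Ω : Type*} [MeasurableSpace Ω] {P : Measure Ω} {γ : Ω → ℝ≥0∞} {F z : ℝ≥0 → ℝ}
  {X : Ω → ℝ} {M : ℝ≥0 → Ω → ℝ} {t : ℝ≥0}

/-- Almost every path of `M` coincides with `F` before the time `γ` and is frozen at the value `X`
from `γ` on. -/
def FollowsUntil (P : Measure Ω) (γ : Ω → ℝ≥0∞) (F : ℝ≥0 → ℝ) (X : Ω → ℝ) (M : ℝ≥0 → Ω → ℝ) :
    Prop :=
  ∀ᵐ ω ∂P, ∀ t : ℝ≥0, M t ω = if (t : ℝ≥0∞) < γ ω then F t else X ω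

lemma FollowsUntil.eq_of_le (hM : FollowsUntil P γ F X M) (t : ℝ≥0) :
    ∀ᵐ ω ∂P, γ ω ≤ t → M t ω = X ω := by
  filter_upwards [hM] with ω hω h
  rw [hω t, if_neg (not_lt.2 h)]

lemma FollowsUntil.eq_of_le_of_le {s : ℝ≥0} (hM : FollowsUntil P γ F X M) (hst : s ≤ t) :
    ∀ᵐ ω ∂P, γ ω ≤ s → M s ω = M t ω := by
  filter_upwards [hM.eq_of_le s, hM.eq_of_le t] with ω hs ht h
  rw [hs h, ht (h.trans (ENNReal.coe_le_coe.2 hst))]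

lemma FollowsUntil.tendsto (hM : FollowsUntil P γ F X M) :
    ∀ᵐ ω ∂P, γ ω < ∞ → Tendsto (fun t => M t ω) atTop (𝓝 (X ω)) := by
  filter_upwards [hM] with ω hω h_lt
  refine tendsto_const_nhds.congr' ?_
  filter_upwards [eventually_ge_atTop (γ ω).toNNReal] with t ht
  have h_le : γ ω ≤ t := (ENNReal.coe_toNNReal h_lt.ne).ge.trans (ENNReal.coe_le_coe.2 ht)
  rw [hω t, if_neg h_le.not_gt]

lemma FollowsUntil.terminal_eq (hM : FollowsUntil P γ F X M) :
    ∀ᵐ ω ∂P, γ ω < ∞ → terminal M ω = X ω := by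
  filter_upwards [hM.tendsto] with ω hω h_lt
  exact (hω h_lt).limUnder_eq

lemma FollowsUntil.integral_terminal (hM : FollowsUntil P γ F X M) (h_fin : ∀ᵐ ω ∂P, γ ω < ∞) :
    ∫ ω, terminal M ω ∂P = ∫ ω, X ω ∂P := by
  refine integral_congr_ae ?_
  filter_upwards [hM.terminal_eq, h_fin] with ω hω h using hω h

lemma FollowsUntil.ae_eq_add_indicator (hM : FollowsUntil P γ F X M) (t : ℝ≥0) :
    M t =ᵐ[P] {ω | γ ω ≤ t}.indicator X + {ω | (t : ℝ≥0∞) < γ ω}.indicator fun _ => F t := by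
  filter_upwards [hM] with ω hω
  rw [hω t]
  by_cases h : (t : ℝ≥0∞) < γ ω
  · simp [h, not_le.2 h]
  · simp [h, not_lt.1 h]

lemma FollowsUntil.integrable [IsFiniteMeasure P] (hγ : Measurable γ)
    (hM : FollowsUntil P γ F X M) (hX : IntegrableOn X {ω | γ ω ≤ t} P) : Integrable (M t) P := by
  refine Integrable.congr ?_ (hM.ae_eq_add_indicator t).symm
  exact ((integrable_indicator_iff (measurableSet_le hγ measurable_const)).2 hX).add
    ((integrable_const _).indicator (measurableSet_lt measurable_const hγ))

lemma lintegral_iSup_le_lintegral_totalVar (P : Measure Ω) (M : ℝ≥0 → Ω → ℝ) :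
    ∫⁻ ω, (⨆ t, ‖M t ω‖ₑ) ∂P ≤ ∫⁻ ω, totalVar M ω ∂P :=
  lintegral_mono fun ω => iSup_le fun t => enorm_le_totalVar M t ω

lemma FollowsUntil.lintegral_leftValue_le [IsProbabilityMeasure P] (hγ : Measurable γ)
    (hM : FollowsUntil P γ F X M) (hF : IsDensity (P.map γ) F z) :
    ∫⁻ s in beforeEnd (P.map γ) ∩ Ioi 0, ‖leftValue (P.map γ) F z s‖ₑ ∂(dG (P.map γ)) ≤
      ∫⁻ ω, (⨆ t, ‖M t ω‖ₑ) ∂P := by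
  have := Measure.isProbabilityMeasure_map (μ := P) hγ.aemeasurable
  have h_meas : MeasurableSet (beforeEnd (P.map γ) ∩ Ioi 0) :=
    measurableSet_beforeEnd.inter measurableSet_Ioi
  rw [restrict_dG_map hγ h_meas]
  refine (lintegral_map_le _ _).trans ((lintegral_mono_ae ?_).trans
    (setLIntegral_le_lintegral _ _))
  filter_upwards [ae_restrict_of_ae hM, ae_restrict_mem
    (hγ (measurableEmbedding_ennreal_coe.measurableSet_image.2 h_meas))] with ω hω h_mem
  obtain ⟨s, ⟨hs, hs0⟩, hsγ⟩ := h_mem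
  have : (𝓝[<] s).NeBot := nhdsLT_neBot_of_exists_lt ⟨0, hs0⟩
  rw [← hsγ, ENNReal.toNNReal_coe]
  refine le_of_tendsto (hF.tendsto_leftValue hs).enorm ?_
  filter_upwards [self_mem_nhdsWithin] with t ht
  have h_eq : M t ω = F t := by rw [hω t, if_pos (hsγ ▸ ENNReal.coe_lt_coe.2 ht)]
  exact h_eq ▸ le_iSup (fun t => ‖M t ω‖ₑ) t

lemma IsDensity.enorm_sub_le {ν : Measure ℝ≥0∞} [IsProbabilityMeasure ν] {s : ℝ≥0}
    (hF : IsDensity ν F z) (hst : s ≤ t) (ht : t ∈ beforeEnd ν) :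
    ‖F t - F s‖ₑ ≤ (((dG ν).restrict (beforeEnd ν)).withDensity fun u => ‖z u‖ₑ) (Ioc s t) := by
  rw [hF.sub_eq_setIntegral hst ht, withDensity_apply _ measurableSet_Ioc,
    Measure.restrict_restrict measurableSet_Ioc,
    inter_eq_left.2 fun u hu => mem_beforeEnd_of_le hu.2 ht]
  exact enorm_integral_le_lintegral_enorm _

lemma FollowsUntil.totalVar_le [IsProbabilityMeasure P] (hγ : Measurable γ)
    (hM : FollowsUntil P γ F X M) (hF : IsDensity (P.map γ) F z) :
    ∀ᵐ ω ∂P, totalVar M ω ≤ 2 * (‖F 0‖ₑ + {ω | γ ω < ∞}.indicator (fun ω => ‖X ω‖ₑ) ω +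
      ∫⁻ u in {u | (u : ℝ≥0∞) < γ ω}, ‖z u‖ₑ ∂((dG (P.map γ)).restrict (beforeEnd (P.map γ)))) := by
  have := Measure.isProbabilityMeasure_map (μ := P) hγ.aemeasurable
  filter_upwards [hM, ae_of_ae_map hγ.aemeasurable (ae_le_endpoint (ν := P.map γ))] with ω hω h_end
  rw [← withDensity_apply _ (measurableSet_lt measurable_coe_nnreal_ennreal measurable_const),
    ← enorm_indicator_eq_indicator_enorm]
  refine enorm_add_eVariationOn_le_of_jump (F := F)
    (fun s t hst ht => hF.enorm_sub_le hst (ht.trans_le h_end)) (fun t ht => ?_) fun t ht => ?_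
  · rw [hω t, if_pos ht]
  · rw [hω t, if_neg (not_lt.2 ht),
      indicator_of_mem (show ω ∈ {ω | γ ω < ∞} from ht.trans_lt ENNReal.coe_lt_top)]

lemma lintegral_setLIntegral_eq_lintegral_tailG [IsProbabilityMeasure P] (hγ : Measurable γ)
    (hz : MemL1loc (P.map γ) z) :
    ∫⁻ ω, ∫⁻ u in {u | (u : ℝ≥0∞) < γ ω}, ‖z u‖ₑ
        ∂((dG (P.map γ)).restrict (beforeEnd (P.map γ))) ∂P =
      ∫⁻ u in beforeEnd (P.map γ), ENNReal.ofReal (tailG (P.map γ) u * |z u|)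
        ∂(dG (P.map γ)) := by
  have := Measure.isProbabilityMeasure_map (μ := P) hγ.aemeasurable
  have h_meas : MeasurableSet {p : Ω × ℝ≥0 | (p.2 : ℝ≥0∞) < γ p.1} :=
    measurableSet_lt (measurable_coe_nnreal_ennreal.comp measurable_snd)
      (hγ.comp measurable_fst)
  refine (lintegral_setLIntegral_swap h_meas hz.aestronglyMeasurable.restrict.enorm).trans ?_
  refine lintegral_congr fun u => ?_
  rw [ENNReal.ofReal_mul (tailG_nonneg u), ofReal_tailG, Measure.map_apply hγ measurableSet_Ioi,
    Real.enorm_eq_ofReal_abs]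
  rfl

lemma FollowsUntil.lintegral_totalVar_lt_top [IsProbabilityMeasure P] (hγ : Measurable γ)
    (hM : FollowsUntil P γ F X M) (hF : IsDensity (P.map γ) F z)
    (hX : IntegrableOn X {ω | γ ω < ∞} P)
    (hz : ∫⁻ s in beforeEnd (P.map γ), ENNReal.ofReal (tailG (P.map γ) s * |z s|)
      ∂(dG (P.map γ)) < ∞) :
    ∫⁻ ω, totalVar M ω ∂P < ∞ := by
  have h_meas : MeasurableSet {ω | γ ω < ∞} := measurableSet_lt hγ measurable_const
  have hX_meas : AEMeasurable ({ω | γ ω < ∞}.indicator fun ω => ‖X ω‖ₑ) P :=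
    (aemeasurable_indicator_iff h_meas).2 hX.1.enorm
  refine (lintegral_mono_ae (hM.totalVar_le hγ hF)).trans_lt ?_
  rw [lintegral_const_mul' _ _ ENNReal.ofNat_ne_top,
    lintegral_add_left' (by exact aemeasurable_const.add hX_meas),
    lintegral_add_left measurable_const, lintegral_const, measure_univ, mul_one,
    lintegral_indicator h_meas, lintegral_setLIntegral_eq_lintegral_tailG hγ hF.1]
  exact ENNReal.mul_lt_top ENNReal.ofNat_lt_top
    (ENNReal.add_lt_top.2 ⟨ENNReal.add_lt_top.2 ⟨enorm_lt_top, hX.2⟩, hz⟩)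

end FollowsUntil

/-! ### Variables with vanishing conditional expectation given the jump time -/

section CondExpZero

variable {Ω : Type*} [MeasurableSpace Ω] {P : Measure Ω} {γ : Ω → ℝ≥0∞} {L' h : Ω → ℝ}
  {B : Set Ω}

lemma CondExpZero.neg (hL : CondExpZero P γ L') : CondExpZero P γ (-L') := by
  refine ⟨?_, ?_⟩
  · simpa only [Pi.neg_apply, enorm_neg] using hL.1
  · simpa only [Pi.neg_apply, neg_neg] using hL.2.symm

variable [IsFiniteMeasure P]

lemma CondExpZero.setLIntegral_ofReal_eq (hL : CondExpZero P γ L') (hγ : Measurable γ)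
    (hB : MeasurableSet[MeasurableSpace.comap γ inferInstance] B) :
    ∫⁻ ω in B, ENNReal.ofReal (L' ω) ∂P = ∫⁻ ω in B, ENNReal.ofReal (-L' ω) ∂P := by
  rw [← setLIntegral_condLExp hγ.comap_le P (fun ω => ENNReal.ofReal (L' ω)) hB,
    ← setLIntegral_condLExp hγ.comap_le P (fun ω => ENNReal.ofReal (-L' ω)) hB]
  exact lintegral_congr_ae (ae_restrict_of_ae hL.2)

lemma CondExpZero.setIntegral_eq_zero (hL : CondExpZero P γ L') (hγ : Measurable γ)
    (hB : MeasurableSet[MeasurableSpace.comap γ inferInstance] B) (hLB : IntegrableOn L' B P) :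
    ∫ ω in B, L' ω ∂P = 0 := by
  rw [integral_eq_lintegral_pos_part_sub_lintegral_neg_part hLB,
    hL.setLIntegral_ofReal_eq hγ hB, sub_self]

lemma CondExpZero.setLIntegral_enorm_le_of_nonneg (hL : CondExpZero P γ L') (hγ : Measurable γ)
    (hL_meas : Measurable L') (hB : MeasurableSet[MeasurableSpace.comap γ inferInstance] B)
    (hLB : ∫⁻ ω in B, ‖L' ω‖ₑ ∂P ≠ ∞) (hh : ∀ ω ∈ B, 0 ≤ h ω) :
    ∫⁻ ω in B, ‖h ω‖ₑ ∂P ≤ ∫⁻ ω in B, ‖h ω + L' ω‖ₑ ∂P := by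
  have h_finite : ∫⁻ ω in B, ENNReal.ofReal (-L' ω) ∂P ≠ ∞ := ne_top_of_le_ne_top hLB
    (lintegral_mono fun ω => (Real.ofReal_le_enorm _).trans_eq (enorm_neg _))
  have h_pointwise : ∀ ω ∈ B, ‖h ω‖ₑ + ENNReal.ofReal (L' ω) ≤
      ‖h ω + L' ω‖ₑ + ENNReal.ofReal (-L' ω) := fun ω hω => by
    rw [Real.enorm_of_nonneg (hh ω hω), Real.enorm_eq_ofReal_abs]
    rcases le_total 0 (L' ω) with hpos | hneg
    · rw [← ENNReal.ofReal_add (hh ω hω) hpos]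
      exact (ENNReal.ofReal_le_ofReal (le_abs_self _)).trans le_self_add
    · rw [ENNReal.ofReal_of_nonpos hneg, add_zero,
        ← ENNReal.ofReal_add (abs_nonneg _) (by linarith)]
      exact ENNReal.ofReal_le_ofReal (by linarith [le_abs_self (h ω + L' ω)])
  refine (ENNReal.add_le_add_iff_right h_finite).1 ?_
  calc ∫⁻ ω in B, ‖h ω‖ₑ ∂P + ∫⁻ ω in B, ENNReal.ofReal (-L' ω) ∂P
      = ∫⁻ ω in B, (‖h ω‖ₑ + ENNReal.ofReal (L' ω)) ∂P := by
        rw [lintegral_add_right _ hL_meas.ennreal_ofReal, hL.setLIntegral_ofReal_eq hγ hB]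
    _ ≤ ∫⁻ ω in B, (‖h ω + L' ω‖ₑ + ENNReal.ofReal (-L' ω)) ∂P :=
        setLIntegral_mono' (hγ.comap_le _ hB) h_pointwise
    _ = ∫⁻ ω in B, ‖h ω + L' ω‖ₑ ∂P + ∫⁻ ω in B, ENNReal.ofReal (-L' ω) ∂P :=
        lintegral_add_right _ hL_meas.neg.ennreal_ofReal

lemma CondExpZero.setLIntegral_enorm_le_of_finite (hL : CondExpZero P γ L') (hγ : Measurable γ)
    (hL_meas : Measurable L') (hh : Measurable[MeasurableSpace.comap γ inferInstance] h)
    (hB : MeasurableSet[MeasurableSpace.comap γ inferInstance] B)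
    (hLB : ∫⁻ ω in B, ‖L' ω‖ₑ ∂P ≠ ∞) :
    ∫⁻ ω in B, ‖h ω‖ₑ ∂P ≤ ∫⁻ ω in B, ‖h ω + L' ω‖ₑ ∂P := by
  have h_sign : MeasurableSet[MeasurableSpace.comap γ inferInstance] {ω | 0 ≤ h ω} :=
    measurableSet_le measurable_const hh
  have h_pos := hL.setLIntegral_enorm_le_of_nonneg (h := h) hγ hL_meas (hB.inter h_sign)
    (ne_top_of_le_ne_top hLB (lintegral_mono_set inter_subset_left)) fun ω hω => hω.2
  have h_neg := hL.neg.setLIntegral_enorm_le_of_nonneg (h := -h) hγ hL_meas.neg (hB.diff h_sign)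
    (by simpa only [Pi.neg_apply, enorm_neg] using
      ne_top_of_le_ne_top hLB (lintegral_mono_set sdiff_subset))
    fun ω hω => neg_nonneg.2 (not_le.1 hω.2).le
  simp only [Pi.neg_apply, ← neg_add, enorm_neg] at h_neg
  rw [← lintegral_inter_add_sdiff _ B (hγ.comap_le _ h_sign),
    ← lintegral_inter_add_sdiff (fun ω => ‖h ω + L' ω‖ₑ) B (hγ.comap_le _ h_sign)]
  exact add_le_add h_pos h_neg

/-- Conditional Jensen inequality for the norm; `L'` is integrable over each of the sets
`{E[|L'| | γ] ≤ n}`, which exhaust the space. -/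
lemma CondExpZero.setLIntegral_enorm_le (hL : CondExpZero P γ L') (hγ : Measurable γ)
    (hL_meas : Measurable L') (hh : Measurable[MeasurableSpace.comap γ inferInstance] h)
    (hB : MeasurableSet[MeasurableSpace.comap γ inferInstance] B) :
    ∫⁻ ω in B, ‖h ω‖ₑ ∂P ≤ ∫⁻ ω in B, ‖h ω + L' ω‖ₑ ∂P := by
  let S (n : ℕ) : Set Ω :=
    {ω | condLExp (MeasurableSpace.comap γ inferInstance) P (fun ω' => ‖L' ω'‖ₑ) ω ≤ n}
  have hS (n : ℕ) : MeasurableSet[MeasurableSpace.comap γ inferInstance] (S n) :=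
    measurableSet_le (measurable_condLExp _ P _) measurable_const
  have h_finite (n : ℕ) : ∫⁻ ω in B ∩ S n, ‖L' ω‖ₑ ∂P ≠ ∞ := by
    rw [← setLIntegral_condLExp hγ.comap_le P _ (hB.inter (hS n))]
    refine ((setLIntegral_mono' (hγ.comap_le _ (hB.inter (hS n))) fun ω hω =>
      hω.2).trans_lt ?_).ne
    rw [setLIntegral_const]
    exact ENNReal.mul_lt_top (ENNReal.natCast_lt_top n) (measure_lt_top P _)
  have h_cover : B =ᵐ[P] ⋃ n, B ∩ S n := by
    filter_upwards [hL.1] with ω hω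
    obtain ⟨n, hn⟩ := ENNReal.exists_nat_gt hω.ne
    rw [← inter_iUnion]
    exact propext (and_iff_left (mem_iUnion.2 ⟨n, hn.le⟩)).symm
  have h_mono : Monotone fun n => B ∩ S n := fun i j hij =>
    inter_subset_inter_right B fun ω hω => le_trans (mem_ofPred_eq ▸ hω) (Nat.cast_le.2 hij)
  rw [setLIntegral_congr h_cover, setLIntegral_congr h_cover,
    setLIntegral_iUnion_of_directed _ h_mono.directed_le,
    setLIntegral_iUnion_of_directed _ h_mono.directed_le]
  exact iSup_mono fun n =>
    hL.setLIntegral_enorm_le_of_finite hγ hL_meas hh (hB.inter (hS n)) (h_finite n)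

end CondExpZero

/-! ### The value frozen at the jump time -/

section JumpValue

variable {Ω : Type*} [MeasurableSpace Ω] {P : Measure Ω} {γ : Ω → ℝ≥0∞} {F H : ℝ≥0 → ℝ}
  {L' : Ω → ℝ} {M : ℝ≥0 → Ω → ℝ}

/-- The value `H(γ) + L'` at which the represented process is frozen from the jump time on. -/
def jumpValue (γ : Ω → ℝ≥0∞) (H : ℝ≥0 → ℝ) (L' : Ω → ℝ) (ω : Ω) : ℝ := H (γ ω).toNNReal + L' ω

lemma IsRepresentedLocalMartingale.followsUntil
    (hM : IsRepresentedLocalMartingale P γ F H L' M) :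
    FollowsUntil P γ F (jumpValue γ H L') M := by
  filter_upwards [hM.representation] with ω hω t
  rw [hω t]
  by_cases ht : (t : ℝ≥0∞) < γ ω
  · simp [ht, not_le.2 ht]
  · simp [not_lt.1 ht, ht, jumpValue]

lemma integrableOn_comp_toNNReal (hγ : Measurable γ) (hH : Integrable H (dG (P.map γ))) :
    IntegrableOn (fun ω => H (γ ω).toNNReal) {ω | γ ω < ∞} P := by
  rw [dG_map hγ] at hH
  exact hH.comp_measurable hγ.ennreal_toNNReal

lemma integrableOn_jumpValue (hγ : Measurable γ) (hH : Integrable H (dG (P.map γ)))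
    (hL : IntegrableOn L' {ω | γ ω < ∞} P) : IntegrableOn (jumpValue γ H L') {ω | γ ω < ∞} P :=
  (integrableOn_comp_toNNReal hγ hH).add hL

lemma integrable_jumpValue (hγ : Measurable γ) (h_fin : ∀ᵐ ω ∂P, γ ω < ∞)
    (hH : Integrable H (dG (P.map γ))) (hL : Integrable L' P) :
    Integrable (jumpValue γ H L') P := by
  rw [← Measure.restrict_eq_self_of_ae_mem (s := {ω | γ ω < ∞}) h_fin]
  exact integrableOn_jumpValue hγ hH hL.integrableOn

lemma setIntegral_jumpValue [IsFiniteMeasure P] (hγ : Measurable γ) {s : Set ℝ≥0}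
    (hs : MeasurableSet s) (hH_meas : AEStronglyMeasurable H (dG (P.map γ)))
    (hH : IntegrableOn H s (dG (P.map γ))) (hL : CondExpZero P γ L')
    (hL_int : IntegrableOn L' (γ ⁻¹' ((↑) '' s)) P) :
    ∫ ω in γ ⁻¹' ((↑) '' s), jumpValue γ H L' ω ∂P = ∫ x in s, H x ∂(dG (P.map γ)) := by
  have h_meas := measurableEmbedding_ennreal_coe.measurableSet_image.2 hs
  rw [setIntegral_dG_map hγ hs hH_meas]
  refine (integral_add ((integrableOn_dG_map hγ hs hH_meas).1 hH) hL_int).trans ?_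
  rw [hL.setIntegral_eq_zero hγ ⟨_, h_meas, rfl⟩ hL_int, add_zero]

lemma CondExpZero.lintegral_dG_enorm_le [IsFiniteMeasure P] (hL : CondExpZero P γ L')
    (hγ : Measurable γ) (hL_meas : Measurable L') (hH : AEStronglyMeasurable H (dG (P.map γ))) :
    ∫⁻ s, ‖H s‖ₑ ∂(dG (P.map γ)) ≤ ∫⁻ ω in {ω | γ ω < ∞}, ‖jumpValue γ H L' ω‖ₑ ∂P := by
  have h_ae : ∀ᵐ ω ∂(P.restrict {ω | γ ω < ∞}), H (γ ω).toNNReal = hH.mk H (γ ω).toNNReal := by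
    have h_mk := hH.ae_eq_mk
    nth_rewrite 1 [dG_map hγ] at h_mk
    exact ae_of_ae_map hγ.ennreal_toNNReal.aemeasurable h_mk
  rw [lintegral_dG_map hγ hH.enorm]
  calc ∫⁻ ω in {ω | γ ω < ∞}, ‖H (γ ω).toNNReal‖ₑ ∂P
      = ∫⁻ ω in {ω | γ ω < ∞}, ‖hH.mk H (γ ω).toNNReal‖ₑ ∂P :=
        lintegral_congr_ae (h_ae.mono fun ω hω => by simp only [hω])
    _ ≤ ∫⁻ ω in {ω | γ ω < ∞}, ‖hH.mk H (γ ω).toNNReal + L' ω‖ₑ ∂P :=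
        hL.setLIntegral_enorm_le hγ hL_meas
          (hH.stronglyMeasurable_mk.measurable.comp (comap_measurable γ).ennreal_toNNReal)
          ⟨Iio ∞, measurableSet_Iio, rfl⟩
    _ = ∫⁻ ω in {ω | γ ω < ∞}, ‖jumpValue γ H L' ω‖ₑ ∂P :=
        lintegral_congr_ae (h_ae.mono fun ω hω => by simp only [jumpValue, hω])

end JumpValue

/-! ### Type 1, Case B and infinite jump times -/

section AtomAtTop

variable {ν : Measure ℝ≥0∞} [IsProbabilityMeasure ν] {F H : ℝ≥0 → ℝ}

lemma real_top_le_tailG (t : ℝ≥0) : ν.real {∞} ≤ tailG ν t := by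
  rw [tailG_eq]
  exact measureReal_mono (singleton_subset_iff.2 ENNReal.coe_lt_top)

lemma beforeEnd_eq_univ (h : 0 < ν {∞}) : beforeEnd ν = univ :=
  eq_univ_of_forall fun t => mem_beforeEnd_iff.2
    ((ENNReal.toReal_pos h.ne' (measure_ne_top _ _)).trans_le (real_top_le_tailG t))

lemma ConditionM.exists_tendsto (hM : ConditionM ν F H) (hH : Integrable H (dG ν))
    (h : 0 < ν {∞}) : ∃ l, Tendsto F atTop (𝓝 l) := by
  have h_top : 0 < ν.real {∞} := ENNReal.toReal_pos h.ne' (measure_ne_top _ _)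
  have h_mul := (hM.tendsto_endMass hH.integrableOn).mono_left
    (atTop_le_toEnd (beforeEnd_eq_univ h))
  have h_tail := tendsto_atTop_ciInf tailG_antitone
    ⟨0, forall_mem_range.2 fun t => tailG_nonneg (ν := ν) t⟩
  have h_inf : 0 < ⨅ t, tailG ν t := h_top.trans_le (le_ciInf real_top_le_tailG)
  exact ⟨_, (h_mul.div h_tail h_inf.ne').congr fun t =>
    mul_div_cancel_right₀ _ (h_top.trans_le (real_top_le_tailG t)).ne'⟩

end AtomAtTop

section GlobalBehaviour

variable {Ω : Type*} [MeasurableSpace Ω] {P : Measure Ω} {γ : Ω → ℝ≥0∞} {F H : ℝ≥0 → ℝ}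
  {X L' : Ω → ℝ} {M : ℝ≥0 → Ω → ℝ}

lemma FollowsUntil.tendsto_piecewise (hM : FollowsUntil P γ F X M) {l : ℝ}
    (hF : ∀ᵐ ω ∂P, γ ω = ∞ → Tendsto F atTop (𝓝 l)) :
    ∀ᵐ ω ∂P, Tendsto (fun t => M t ω) atTop (𝓝 ({ω | γ ω < ∞}.piecewise X (fun _ => l) ω)) := by
  filter_upwards [hM, hM.tendsto, hF] with ω hω h_lt hF
  rcases lt_or_eq_of_le (le_top : γ ω ≤ ∞) with h | h
  · rw [piecewise_eq_of_mem _ _ _ (show ω ∈ {ω | γ ω < ∞} from h)]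
    exact h_lt h
  · rw [piecewise_eq_of_notMem _ _ _ (show ω ∉ {ω | γ ω < ∞} from h.not_lt)]
    refine (hF h).congr fun t => ?_
    rw [hω t, h, if_pos ENNReal.coe_lt_top]

lemma FollowsUntil.hasLimit (hM : FollowsUntil P γ F X M) {l : ℝ}
    (hF : ∀ᵐ ω ∂P, γ ω = ∞ → Tendsto F atTop (𝓝 l)) : HasLimit P M :=
  (hM.tendsto_piecewise hF).mono fun _ h => ⟨_, h⟩

lemma FollowsUntil.integrable_terminal [IsFiniteMeasure P] (hM : FollowsUntil P γ F X M)
    (hγ : Measurable γ) {l : ℝ} (hF : ∀ᵐ ω ∂P, γ ω = ∞ → Tendsto F atTop (𝓝 l))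
    (hX : IntegrableOn X {ω | γ ω < ∞} P) : Integrable (terminal M) P :=
  (Integrable.piecewise (measurableSet_lt hγ measurable_const) hX
    (integrable_const l).integrableOn).congr
      ((hM.tendsto_piecewise hF).mono fun _ h => h.limUnder_eq.symm)

variable [IsProbabilityMeasure P]

lemma IsRepresentedLocalMartingale.integrable_of_terminal
    (hM : IsRepresentedLocalMartingale P γ F H L' M) (hγ : Measurable γ)
    (h_term : ∫⁻ ω, ‖terminal M ω‖ₑ ∂P < ∞) :
    Integrable H (dG (P.map γ)) ∧ IntegrableOn L' {ω | γ ω < ∞} P := by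
  have := Measure.isProbabilityMeasure_map (μ := P) hγ.aemeasurable
  have hH := hM.conditionM.memL1loc.aestronglyMeasurable
  have h_jump : ∫⁻ ω in {ω | γ ω < ∞}, ‖jumpValue γ H L' ω‖ₑ ∂P < ∞ := by
    refine lt_of_eq_of_lt (setLIntegral_congr_fun_ae (measurableSet_lt hγ measurable_const) ?_)
      ((setLIntegral_le_lintegral _ _).trans_lt h_term)
    filter_upwards [hM.followsUntil.terminal_eq] with ω hω h
    rw [hω h]
  have hH_int : Integrable H (dG (P.map γ)) :=
    ⟨hH, (hM.condExpZero_L'.lintegral_dG_enorm_le hγ hM.measurable_L' hH).trans_lt h_jump⟩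
  have hH_comp := integrableOn_comp_toNNReal hγ hH_int
  have h_jump_int : IntegrableOn (jumpValue γ H L') {ω | γ ω < ∞} P :=
    ⟨hH_comp.1.add hM.measurable_L'.aestronglyMeasurable, h_jump⟩
  refine ⟨hH_int, (h_jump_int.sub hH_comp).congr (.of_forall fun ω => ?_)⟩
  exact add_sub_cancel_left _ _

lemma IsRepresentedLocalMartingale.exists_tendsto_of_eq_top
    (hM : IsRepresentedLocalMartingale P γ F H L' M) (hγ : Measurable γ)
    (hH : Integrable H (dG (P.map γ))) :
    ∃ l, ∀ᵐ ω ∂P, γ ω = ∞ → Tendsto F atTop (𝓝 l) := by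
  have := Measure.isProbabilityMeasure_map (μ := P) hγ.aemeasurable
  rcases eq_zero_or_pos (P.map γ {∞}) with h | h
  · rw [Measure.map_apply hγ (measurableSet_singleton _)] at h
    exact ⟨0, (measure_eq_zero_iff_ae_notMem.1 h).mono fun _ hω h_top => absurd h_top hω⟩
  · obtain ⟨l, hl⟩ := hM.conditionM.exists_tendsto hH h
    exact ⟨l, .of_forall fun _ _ => hl⟩

lemma hasType1_iff (hγ : Measurable γ) (hM : IsRepresentedLocalMartingale P γ F H L' M)
    (hA : CaseA (P.map γ)) :
    HasType (singleJumpFiltration γ) P M .type1 ↔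
      (∫⁻ ω in {ω | γ ω < ∞}, ‖L' ω‖ₑ ∂P = ∞ ∨
        ∫⁻ s in beforeEnd (P.map γ), ‖H s‖ₑ ∂(dG (P.map γ)) = ∞) := by
  have := Measure.isProbabilityMeasure_map (μ := P) hγ.aemeasurable
  rw [restrict_beforeEnd hA, HasType, ← not_iff_not, not_or, not_or, not_not, not_and]
  constructor
  · rintro ⟨h_lim, h_term⟩
    obtain ⟨hH, hL⟩ := hM.integrable_of_terminal hγ (lt_top_iff_ne_top.2 (h_term h_lim))
    exact ⟨hL.2.ne, hH.2.ne⟩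
  · rintro ⟨hL, hH⟩
    have hH_int : Integrable H (dG (P.map γ)) :=
      ⟨hM.conditionM.memL1loc.aestronglyMeasurable, lt_top_iff_ne_top.2 hH⟩
    have hX := integrableOn_jumpValue hγ hH_int
      ⟨hM.measurable_L'.aestronglyMeasurable, lt_top_iff_ne_top.2 hL⟩
    obtain ⟨l, hl⟩ := hM.exists_tendsto_of_eq_top hγ hH_int
    exact ⟨hM.followsUntil.hasLimit hl, fun _ =>
      (hM.followsUntil.integrable_terminal hγ hl hX).2.ne⟩

lemma hasType4_of_eq_top_pos (hγ : Measurable γ) (hM : IsRepresentedLocalMartingale P γ F H L' M)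
    (h_top : 0 < P {ω | γ ω = ∞}) (hL : ∫⁻ ω in {ω | γ ω < ∞}, ‖L' ω‖ₑ ∂P < ∞)
    (hH : ∫⁻ s, ‖H s‖ₑ ∂(dG (P.map γ)) < ∞) :
    HasType (singleJumpFiltration γ) P M .type4 := by
  have := Measure.isProbabilityMeasure_map (μ := P) hγ.aemeasurable
  have hH_int : Integrable H (dG (P.map γ)) := ⟨hM.conditionM.memL1loc.aestronglyMeasurable, hH⟩
  have h_atom : 0 < (P.map γ).real {∞} := by
    rw [map_measureReal_apply hγ (measurableSet_singleton _)]
    exact ENNReal.toReal_pos h_top.ne' (measure_ne_top _ _)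
  obtain ⟨z, hz⟩ := hM.conditionM.absCont
  exact hM.followsUntil.lintegral_totalVar_lt_top hγ hz
    (integrableOn_jumpValue hγ hH_int ⟨hM.measurable_L'.aestronglyMeasurable, hL⟩)
    (hz.lintegral_tailG_mul_lt_top_of_le_tailG hM.conditionM hH_int.integrableOn h_atom
      fun t _ => real_top_le_tailG t)

lemma hasType4_of_caseB (hγ : Measurable γ) (hM : IsRepresentedLocalMartingale P γ F H L' M)
    (hB : CaseB (P.map γ)) : HasType (singleJumpFiltration γ) P M .type4 := by
  have := Measure.isProbabilityMeasure_map (μ := P) hγ.aemeasurable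
  have h_coe := ENNReal.coe_toNNReal hB.endpoint_lt_top.ne
  have hL : IntegrableOn L' {ω | γ ω < ∞} P := by
    refine (hM.integrableOn_L' _ (hB.mem_timeSet h_coe.le)).mono_set_ae ?_
    filter_upwards [ae_of_ae_map hγ.aemeasurable ae_le_endpoint] with ω hω _
    exact hω.trans_eq h_coe.symm
  obtain ⟨z, hz⟩ := hM.conditionM.absCont
  refine hM.followsUntil.lintegral_totalVar_lt_top hγ hz
    (integrableOn_jumpValue hγ (hM.conditionM.memL1loc.integrable_of_caseB hB) hL) ?_
  calc ∫⁻ s in beforeEnd (P.map γ), ENNReal.ofReal (tailG (P.map γ) s * |z s|) ∂(dG (P.map γ))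
      ≤ ∫⁻ s, ‖z s‖ₑ ∂(dG (P.map γ)) := by
        refine (setLIntegral_le_lintegral _ _).trans (lintegral_mono fun s => ?_)
        rw [Real.enorm_eq_ofReal_abs]
        exact ENNReal.ofReal_le_ofReal (mul_le_of_le_one_left (abs_nonneg _) (tailG_le_one s))
    _ < ∞ := (hz.1.integrable_of_caseB hB).2

end GlobalBehaviour

/-! ### Conditional expectations in the single jump filtration -/

section CondExp

variable {Ω : Type*} [mΩ : MeasurableSpace Ω] {P : Measure Ω} {γ : Ω → ℝ≥0∞}
  {X Y N : Ω → ℝ} {M : ℝ≥0 → Ω → ℝ} {s t : ℝ≥0}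

lemma measurableSet_singleJumpFiltration {A : Set Ω} :
    MeasurableSet[singleJumpFiltration γ t] A ↔ MeasurableSet A ∧
      (A ∩ {ω | (t : ℝ≥0∞) < γ ω} = ∅ ∨
        A ∩ {ω | (t : ℝ≥0∞) < γ ω} = {ω | (t : ℝ≥0∞) < γ ω}) := Iff.rfl

variable [IsFiniteMeasure P]

/-- A set of the `s`-th `σ`-field either misses or contains `{s < γ}`, so only the integrals over
the latter set have to be compared. -/
lemma condExp_le_of_setIntegral_le (hY : Integrable Y P) (hN : Integrable N P)
    (hN_meas : StronglyMeasurable[singleJumpFiltration γ s] N)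
    (h_eq : ∀ᵐ ω ∂P, γ ω ≤ s → N ω = Y ω)
    (h_le : ∫ ω in {ω | (s : ℝ≥0∞) < γ ω}, Y ω ∂P ≤ ∫ ω in {ω | (s : ℝ≥0∞) < γ ω}, N ω ∂P) :
    P[Y | singleJumpFiltration γ s] ≤ᵐ[P] N := by
  have hm := (singleJumpFiltration γ).le s
  have h_meas : StronglyMeasurable[singleJumpFiltration γ s]
      (N - P[Y | singleJumpFiltration γ s]) := hN_meas.sub stronglyMeasurable_condExp
  suffices 0 ≤ᵐ[P.trim hm] N - P[Y | singleJumpFiltration γ s] from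
    (ae_le_of_ae_le_trim this).mono fun ω hω => sub_nonneg.1 hω
  refine ae_nonneg_of_forall_setIntegral_nonneg
    ((hN.sub integrable_condExp).trim hm h_meas) fun A hA _ => ?_
  obtain ⟨hA_meas, hA_jump⟩ := measurableSet_singleJumpFiltration.1 hA
  have h_inter : ∫ ω in A, (N ω - Y ω) ∂P =
      ∫ ω in A ∩ {ω | (s : ℝ≥0∞) < γ ω}, (N ω - Y ω) ∂P := by
    refine setIntegral_eq_of_subset_of_ae_sdiff_eq_zero hA_meas.nullMeasurableSet
      inter_subset_left ?_
    filter_upwards [h_eq] with ω hω h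
    rw [hω (not_lt.1 fun h_lt => h.2 ⟨h.1, h_lt⟩), sub_self]
  rw [← setIntegral_trim hm h_meas hA, integral_sub' hN.integrableOn
    integrable_condExp.integrableOn, setIntegral_condExp hm hY hA,
    ← integral_sub hN.integrableOn hY.integrableOn, h_inter]
  rcases hA_jump with h | h
  · rw [h, setIntegral_empty]
  · rw [h, integral_sub hN.integrableOn hY.integrableOn]
    exact sub_nonneg.2 h_le

lemma le_condExp_of_setIntegral_le (hY : Integrable Y P) (hN : Integrable N P)
    (hN_meas : StronglyMeasurable[singleJumpFiltration γ s] N)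
    (h_eq : ∀ᵐ ω ∂P, γ ω ≤ s → N ω = Y ω)
    (h_le : ∫ ω in {ω | (s : ℝ≥0∞) < γ ω}, N ω ∂P ≤ ∫ ω in {ω | (s : ℝ≥0∞) < γ ω}, Y ω ∂P) :
    N ≤ᵐ[P] P[Y | singleJumpFiltration γ s] := by
  have h_neg := condExp_le_of_setIntegral_le hY.neg hN.neg hN_meas.neg
    (h_eq.mono fun ω h hs => by rw [Pi.neg_apply, Pi.neg_apply, h hs])
    (by simpa only [Pi.neg_apply, integral_neg, neg_le_neg_iff] using h_le)
  filter_upwards [h_neg, condExp_neg Y (singleJumpFiltration γ s)] with ω h_le h_eq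
  rw [h_eq] at h_le
  exact neg_le_neg_iff.1 h_le

lemma isUIMartingale_of_condExp_eq {𝓕 : Filtration ℝ≥0 mΩ} (hY : Integrable Y P)
    (hM : StronglyAdapted 𝓕 M) (h : ∀ t, P[Y | 𝓕 t] =ᵐ[P] M t) : IsUIMartingale 𝓕 P M := by
  refine ⟨⟨hM, fun s t hst => ?_⟩, ?_⟩
  · calc P[M t | 𝓕 s] =ᵐ[P] P[P[Y | 𝓕 t] | 𝓕 s] := condExp_congr_ae (h t).symm
      _ =ᵐ[P] P[Y | 𝓕 s] := condExp_condExp_of_le (𝓕.mono hst) (𝓕.le t)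
      _ =ᵐ[P] M s := h s
  · exact (uniformIntegrable_congr_ae h).1 hY.uniformIntegrable_condExp_filtration

lemma IsUIMartingale.integral_eq_of_tendsto {𝓕 : Filtration ℝ≥0 mΩ} (hM : IsUIMartingale 𝓕 P M)
    (hX : Integrable X P) (h_lim : ∀ᵐ ω ∂P, Tendsto (fun t => M t ω) atTop (𝓝 (X ω))) (t : ℝ≥0) :
    ∫ ω, M t ω ∂P = ∫ ω, X ω ∂P := by
  let T (n : ℕ) : ℝ≥0 := t + n
  have hT : Tendsto T atTop atTop :=
    tendsto_atTop_mono (fun _ => le_add_self) tendsto_natCast_atTop_atTop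
  have h_unif : UnifIntegrable (fun n => M (T n)) 1 P := by
    intro ε hε
    obtain ⟨δ, hδ, h⟩ := hM.2.2.1 hε
    exact ⟨δ, hδ, fun n => h (T n)⟩
  have h_L1 := tendsto_Lp_finite_of_tendsto_ae le_rfl ENNReal.one_ne_top
    (fun n => (hM.1.integrable (T n)).aestronglyMeasurable) (memLp_one_iff_integrable.2 hX)
    h_unif (h_lim.mono fun ω hω => hω.comp hT)
  have h_const (n : ℕ) : ∫ ω, M (T n) ω ∂P = ∫ ω, M t ω ∂P := by
    simpa only [setIntegral_univ] using
      (hM.1.setIntegral_eq (show t ≤ T n from le_self_add) MeasurableSet.univ).symm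
  exact tendsto_nhds_unique (tendsto_const_nhds.congr fun n => (h_const n).symm)
    (tendsto_integral_of_L1' X hX.aestronglyMeasurable
      (.of_forall fun n => hM.1.integrable (T n)) h_L1)

end CondExp

/-! ### The defect of a process frozen at the jump time -/

section Defect

variable {Ω : Type*} [MeasurableSpace Ω] {P : Measure Ω} [IsFiniteMeasure P] {γ : Ω → ℝ≥0∞}
  {F : ℝ≥0 → ℝ} {X : Ω → ℝ} {M : ℝ≥0 → Ω → ℝ} {s t : ℝ≥0}

/-- The quantity `F(t) P(t < γ) - E[X; t < γ]`, whose vanishing expresses that the process which is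
`F` before `γ` and `X` afterwards is closed by `X` at time `t`. -/
noncomputable def defect (P : Measure Ω) (γ : Ω → ℝ≥0∞) (F : ℝ≥0 → ℝ) (X : Ω → ℝ) (t : ℝ≥0) : ℝ :=
  ∫ ω in {ω | (t : ℝ≥0∞) < γ ω}, (F t - X ω) ∂P

lemma FollowsUntil.setIntegral_eq (hM : FollowsUntil P γ F X M) (hγ : Measurable γ)
    (hX : Integrable X P) {A : Set Ω} (hA : {ω | (t : ℝ≥0∞) < γ ω} ⊆ A) :
    ∫ ω in A, M t ω ∂P = ∫ ω in A, X ω ∂P + defect P γ F X t := by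
  have h_meas : MeasurableSet {ω | (t : ℝ≥0∞) < γ ω} := measurableSet_lt measurable_const hγ
  have h_int : Integrable ({ω | (t : ℝ≥0∞) < γ ω}.indicator fun ω => F t - X ω) P :=
    ((integrable_const _).sub hX).indicator h_meas
  have h_eq : M t =ᵐ[P] X + {ω | (t : ℝ≥0∞) < γ ω}.indicator fun ω => F t - X ω := by
    filter_upwards [hM] with ω hω
    rw [hω t, Pi.add_apply, indicator_apply]
    by_cases h : (t : ℝ≥0∞) < γ ω <;> simp [h]
  rw [integral_congr_ae (ae_restrict_of_ae h_eq), integral_add' hX.integrableOn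
    h_int.integrableOn, setIntegral_indicator h_meas, inter_eq_right.2 hA, defect]

lemma FollowsUntil.integral_eq (hM : FollowsUntil P γ F X M) (hγ : Measurable γ)
    (hX : Integrable X P) (t : ℝ≥0) : ∫ ω, M t ω ∂P = ∫ ω, X ω ∂P + defect P γ F X t := by
  simpa only [setIntegral_univ] using hM.setIntegral_eq hγ hX (subset_univ _)

lemma FollowsUntil.setIntegral_eq_of_le (hM : FollowsUntil P γ F X M) (hγ : Measurable γ)
    (hX : Integrable X P) (hst : s ≤ t) :
    ∫ ω in {ω | (s : ℝ≥0∞) < γ ω}, M t ω ∂P =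
      ∫ ω in {ω | (s : ℝ≥0∞) < γ ω}, X ω ∂P + defect P γ F X t :=
  hM.setIntegral_eq hγ hX fun _ hω => (ENNReal.coe_le_coe.2 hst).trans_lt hω

lemma FollowsUntil.isClosedSupermartingale (hM : FollowsUntil P γ F X M) (hγ : Measurable γ)
    (hX : Integrable X P) (h_adapted : StronglyAdapted (singleJumpFiltration γ) M)
    (h_fin : ∀ᵐ ω ∂P, γ ω < ∞) (h_anti : Antitone (defect P γ F X))
    (h_nonneg : ∀ t, 0 ≤ defect P γ F X t) :
    IsClosedSupermartingale (singleJumpFiltration γ) P M := by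
  have h_int (t : ℝ≥0) : Integrable (M t) P := hM.integrable hγ hX.integrableOn
  have h_term : terminal M =ᵐ[P] X := by
    filter_upwards [hM.terminal_eq, h_fin] with ω hω h using hω h
  refine ⟨⟨h_adapted, fun s t hst => ?_, h_int⟩,
    hM.hasLimit (l := 0) (h_fin.mono fun ω hω h => absurd h hω.ne), hX.congr h_term.symm,
    fun t => (condExp_congr_ae h_term).trans_le ?_⟩
  · refine condExp_le_of_setIntegral_le (h_int t) (h_int s) (h_adapted s) (hM.eq_of_le_of_le hst) ?_
    rw [hM.setIntegral_eq_of_le hγ hX hst, hM.setIntegral_eq_of_le hγ hX le_rfl]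
    exact add_le_add_right (h_anti hst) _
  · refine condExp_le_of_setIntegral_le hX (h_int t) (h_adapted t) (hM.eq_of_le t) ?_
    rw [hM.setIntegral_eq_of_le hγ hX le_rfl]
    exact le_add_of_nonneg_right (h_nonneg t)

lemma FollowsUntil.isClosedSubmartingale (hM : FollowsUntil P γ F X M) (hγ : Measurable γ)
    (hX : Integrable X P) (h_adapted : StronglyAdapted (singleJumpFiltration γ) M)
    (h_fin : ∀ᵐ ω ∂P, γ ω < ∞) (h_mono : Monotone (defect P γ F X))
    (h_nonpos : ∀ t, defect P γ F X t ≤ 0) :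
    IsClosedSubmartingale (singleJumpFiltration γ) P M := by
  have h_int (t : ℝ≥0) : Integrable (M t) P := hM.integrable hγ hX.integrableOn
  have h_term : terminal M =ᵐ[P] X := by
    filter_upwards [hM.terminal_eq, h_fin] with ω hω h using hω h
  refine ⟨⟨h_adapted, fun s t hst => ?_, h_int⟩,
    hM.hasLimit (l := 0) (h_fin.mono fun ω hω h => absurd h hω.ne), hX.congr h_term.symm,
    fun t => EventuallyLE.trans_eq ?_ (condExp_congr_ae h_term).symm⟩
  · refine le_condExp_of_setIntegral_le (h_int t) (h_int s) (h_adapted s) (hM.eq_of_le_of_le hst) ?_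
    rw [hM.setIntegral_eq_of_le hγ hX hst, hM.setIntegral_eq_of_le hγ hX le_rfl]
    exact add_le_add_right (h_mono hst) _
  · refine le_condExp_of_setIntegral_le hX (h_int t) (h_adapted t) (hM.eq_of_le t) ?_
    rw [hM.setIntegral_eq_of_le hγ hX le_rfl]
    exact add_le_of_nonpos_right (h_nonpos t)

lemma FollowsUntil.isUIMartingale (hM : FollowsUntil P γ F X M) (hγ : Measurable γ)
    (hX : Integrable X P) (h_adapted : StronglyAdapted (singleJumpFiltration γ) M)
    (h_zero : ∀ t, defect P γ F X t = 0) : IsUIMartingale (singleJumpFiltration γ) P M := by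
  refine isUIMartingale_of_condExp_eq hX h_adapted fun t => ?_
  have h_int : Integrable (M t) P := hM.integrable hγ hX.integrableOn
  have h_eq : ∫ ω in {ω | (t : ℝ≥0∞) < γ ω}, M t ω ∂P = ∫ ω in {ω | (t : ℝ≥0∞) < γ ω}, X ω ∂P := by
    rw [hM.setIntegral_eq_of_le hγ hX le_rfl, h_zero, add_zero]
  exact (condExp_le_of_setIntegral_le hX h_int (h_adapted t) (hM.eq_of_le t) h_eq.ge).antisymm
    (le_condExp_of_setIntegral_le hX h_int (h_adapted t) (hM.eq_of_le t) h_eq.le)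

end Defect

/-! ### Finite jump time without an atom at the endpoint -/

section FiniteJumpTime

variable {Ω : Type*} [MeasurableSpace Ω] {P : Measure Ω} [IsProbabilityMeasure P] {γ : Ω → ℝ≥0∞}
  {F H z : ℝ≥0 → ℝ} {X L' : Ω → ℝ} {M : ℝ≥0 → Ω → ℝ}

lemma FollowsUntil.tfae_lintegral_lt_top (hM : FollowsUntil P γ F X M) (hγ : Measurable γ)
    (hF : IsDensity (P.map γ) F z) (hFH : ConditionM (P.map γ) F H)
    (hH : Integrable H (dG (P.map γ))) (hX : IntegrableOn X {ω | γ ω < ∞} P) :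
    List.TFAE [∫⁻ ω, totalVar M ω ∂P < ∞, ∫⁻ ω, (⨆ t, ‖M t ω‖ₑ) ∂P < ∞,
      ∫⁻ s in beforeEnd (P.map γ), ENNReal.ofReal (tailG (P.map γ) s * |z s|)
        ∂(dG (P.map γ)) < ∞] := by
  have := Measure.isProbabilityMeasure_map (μ := P) hγ.aemeasurable
  tfae_have 1 → 2 := (lintegral_iSup_le_lintegral_totalVar P M).trans_lt
  tfae_have 2 → 3 := fun h => hF.lintegral_tailG_mul_lt_top hFH hH.integrableOn
    ((hM.lintegral_leftValue_le hγ hF).trans_lt h)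
  tfae_have 3 → 1 := hM.lintegral_totalVar_lt_top hγ hF hX
  tfae_finish

lemma endMass_eq_zero {ν : Measure ℝ≥0∞} [IsProbabilityMeasure ν] (h : 0 ∉ beforeEnd ν) :
    endMass ν F H = 0 := by
  have h_empty : beforeEnd ν = ∅ :=
    eq_empty_of_forall_notMem fun t ht => h (mem_beforeEnd_of_le zero_le ht)
  rw [endMass, tailG_eq_zero h, h_empty, empty_inter, setIntegral_empty, mul_zero, sub_zero]

lemma ConditionM.defect_eq (hM : ConditionM (P.map γ) F H) (hγ : Measurable γ)
    (hA : CaseA (P.map γ)) (h_fin : ∀ᵐ ω ∂P, γ ω < ∞) (hH : Integrable H (dG (P.map γ)))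
    (hL : CondExpZero P γ L') (hL_int : Integrable L' P) (t : ℝ≥0) :
    defect P γ F (jumpValue γ H L') t =
      (beforeEnd (P.map γ)).indicator (fun _ => endMass (P.map γ) F H) t := by
  have := Measure.isProbabilityMeasure_map (μ := P) hγ.aemeasurable
  have hX : IntegrableOn (jumpValue γ H L') {ω | (t : ℝ≥0∞) < γ ω} P :=
    (integrableOn_jumpValue hγ hH hL_int.integrableOn).mono_set_ae
      (h_fin.mono fun ω hω _ => hω)
  have h_set : {ω | (t : ℝ≥0∞) < γ ω} =ᵐ[P] γ ⁻¹' ((↑) '' Ioi t) := by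
    filter_upwards [h_fin] with ω hω
    rw [ENNReal.image_coe_Ioi]
    exact propext (and_iff_left hω).symm
  have h_jump : ∫ ω in {ω | (t : ℝ≥0∞) < γ ω}, jumpValue γ H L' ω ∂P =
      ∫ s in beforeEnd (P.map γ) ∩ Ioi t, H s ∂(dG (P.map γ)) := by
    rw [setIntegral_congr_set h_set, setIntegral_jumpValue hγ measurableSet_Ioi
      hH.aestronglyMeasurable hH.integrableOn hL hL_int.integrableOn, inter_comm,
      ← Measure.restrict_restrict measurableSet_Ioi, restrict_beforeEnd hA]
  by_cases ht : t ∈ beforeEnd (P.map γ)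
  · rw [indicator_of_mem ht, defect, integral_sub (integrable_const _) hX, setIntegral_const,
      ← tailG_map hγ, smul_eq_mul, mul_comm, hM.mul_tailG_eq hH.integrableOn ht, h_jump,
      add_sub_cancel_right]
  · rw [indicator_of_notMem ht, defect]
    refine setIntegral_measure_zero _ ((measureReal_eq_zero_iff).1 ?_)
    rw [← tailG_map hγ, tailG_eq_zero ht]

lemma antitone_indicator_beforeEnd {ν : Measure ℝ≥0∞} {c : ℝ} (hc : 0 ≤ c) :
    Antitone ((beforeEnd ν).indicator fun _ => c) := by
  intro s t hst
  by_cases ht : t ∈ beforeEnd ν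
  · rw [indicator_of_mem ht, indicator_of_mem (mem_beforeEnd_of_le hst ht)]
  · rw [indicator_of_notMem ht]
    exact indicator_nonneg (fun _ _ => hc) s

lemma monotone_indicator_beforeEnd {ν : Measure ℝ≥0∞} {c : ℝ} (hc : c ≤ 0) :
    Monotone ((beforeEnd ν).indicator fun _ => c) := by
  intro s t hst
  by_cases ht : t ∈ beforeEnd ν
  · rw [indicator_of_mem ht, indicator_of_mem (mem_beforeEnd_of_le hst ht)]
  · rw [indicator_of_notMem ht]
    exact indicator_nonpos (fun _ _ => hc) s

lemma IsRepresentedLocalMartingale.defect_eq (hM : IsRepresentedLocalMartingale P γ F H L' M)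
    (hγ : Measurable γ) (hA : CaseA (P.map γ)) (h_fin : ∀ᵐ ω ∂P, γ ω < ∞)
    (hH : Integrable H (dG (P.map γ))) (hL : Integrable L' P) :
    defect P γ F (jumpValue γ H L') =
      (beforeEnd (P.map γ)).indicator fun _ => endMass (P.map γ) F H :=
  funext fun t => hM.conditionM.defect_eq hγ hA h_fin hH hM.condExpZero_L' hL t

lemma IsRepresentedLocalMartingale.integral_zero_eq
    (hM : IsRepresentedLocalMartingale P γ F H L' M)
    (hγ : Measurable γ) (hA : CaseA (P.map γ)) (h_fin : ∀ᵐ ω ∂P, γ ω < ∞)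
    (hH : Integrable H (dG (P.map γ))) (hL : Integrable L' P) :
    ∫ ω, M 0 ω ∂P = ∫ ω, jumpValue γ H L' ω ∂P + endMass (P.map γ) F H := by
  have := Measure.isProbabilityMeasure_map (μ := P) hγ.aemeasurable
  rw [hM.followsUntil.integral_eq hγ (integrable_jumpValue hγ h_fin hH hL),
    hM.defect_eq hγ hA h_fin hH hL]
  by_cases h0 : 0 ∈ beforeEnd (P.map γ)
  · rw [indicator_of_mem h0]
  · rw [indicator_of_notMem h0, endMass_eq_zero h0]

lemma hasType2a_iff (hM : IsRepresentedLocalMartingale P γ F H L' M)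
    (hγ : Measurable γ) (hA : CaseA (P.map γ)) (h_fin : ∀ᵐ ω ∂P, γ ω < ∞)
    (hH : Integrable H (dG (P.map γ))) (hL : Integrable L' P) :
    HasType (singleJumpFiltration γ) P M .type2a ↔ 0 < endMass (P.map γ) F H := by
  rw [HasType, hM.followsUntil.integral_terminal h_fin,
    hM.integral_zero_eq hγ hA h_fin hH hL, lt_add_iff_pos_right]
  refine and_iff_right_of_imp fun h => hM.followsUntil.isClosedSupermartingale hγ
    (integrable_jumpValue hγ h_fin hH hL) hM.localMartingale.adapted h_fin ?_ ?_
  all_goals rw [hM.defect_eq hγ hA h_fin hH hL]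
  · exact antitone_indicator_beforeEnd h.le
  · exact indicator_nonneg fun _ _ => h.le

lemma hasType2b_iff (hM : IsRepresentedLocalMartingale P γ F H L' M)
    (hγ : Measurable γ) (hA : CaseA (P.map γ)) (h_fin : ∀ᵐ ω ∂P, γ ω < ∞)
    (hH : Integrable H (dG (P.map γ))) (hL : Integrable L' P) :
    HasType (singleJumpFiltration γ) P M .type2b ↔ endMass (P.map γ) F H < 0 := by
  rw [HasType, hM.followsUntil.integral_terminal h_fin,
    hM.integral_zero_eq hγ hA h_fin hH hL, add_lt_iff_neg_left]
  refine and_iff_right_of_imp fun h => hM.followsUntil.isClosedSubmartingale hγ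
    (integrable_jumpValue hγ h_fin hH hL) hM.localMartingale.adapted h_fin ?_ ?_
  all_goals rw [hM.defect_eq hγ hA h_fin hH hL]
  · exact monotone_indicator_beforeEnd h.le
  · exact indicator_nonpos fun _ _ => h.le

lemma isUIMartingale_iff (hM : IsRepresentedLocalMartingale P γ F H L' M)
    (hγ : Measurable γ) (hA : CaseA (P.map γ)) (h_fin : ∀ᵐ ω ∂P, γ ω < ∞)
    (hH : Integrable H (dG (P.map γ))) (hL : Integrable L' P) :
    IsUIMartingale (singleJumpFiltration γ) P M ↔ endMass (P.map γ) F H = 0 := by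
  have hX := integrable_jumpValue hγ h_fin hH hL
  refine ⟨fun h => ?_, fun h => ?_⟩
  · have h_lim : ∀ᵐ ω ∂P, Tendsto (fun t => M t ω) atTop (𝓝 (jumpValue γ H L' ω)) := by
      filter_upwards [hM.followsUntil.tendsto, h_fin] with ω hω h_lt using hω h_lt
    have h_zero := h.integral_eq_of_tendsto hX h_lim 0
    rwa [hM.integral_zero_eq hγ hA h_fin hH hL, add_eq_left] at h_zero
  · refine hM.followsUntil.isUIMartingale hγ hX hM.localMartingale.adapted fun t => ?_
    rw [hM.defect_eq hγ hA h_fin hH hL, h, indicator_zero]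

lemma types_of_finite (hM : IsRepresentedLocalMartingale P γ F H L' M) (hγ : Measurable γ)
    (hA : CaseA (P.map γ)) (h_fin : P {ω | γ ω = ∞} = 0) (hL : ∫⁻ ω, ‖L' ω‖ₑ ∂P < ∞)
    (hH : ∫⁻ s in beforeEnd (P.map γ), ‖H s‖ₑ ∂(dG (P.map γ)) < ∞)
    (hz : IsDensity (P.map γ) F z) :
    ∃ l : ℝ, Tendsto (fun t => F t * tailG (P.map γ) t) (toEnd (P.map γ)) (𝓝 l) ∧
      (HasType (singleJumpFiltration γ) P M .type2a ↔ 0 < l) ∧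
      (HasType (singleJumpFiltration γ) P M .type2b ↔ l < 0) ∧
      (HasType (singleJumpFiltration γ) P M .type3 ↔
        (l = 0 ∧ ∫⁻ s in beforeEnd (P.map γ),
          ENNReal.ofReal (tailG (P.map γ) s * |z s|) ∂(dG (P.map γ)) = ∞)) ∧
      (HasType (singleJumpFiltration γ) P M .type4 ↔
        ∫⁻ s in beforeEnd (P.map γ),
          ENNReal.ofReal (tailG (P.map γ) s * |z s|) ∂(dG (P.map γ)) < ∞) := by
  have := Measure.isProbabilityMeasure_map (μ := P) hγ.aemeasurable
  rw [restrict_beforeEnd hA] at hH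
  have hH_int : Integrable H (dG (P.map γ)) := ⟨hM.conditionM.memL1loc.aestronglyMeasurable, hH⟩
  have hL_int : Integrable L' P := ⟨hM.measurable_L'.aestronglyMeasurable, hL⟩
  have h_lt : ∀ᵐ ω ∂P, γ ω < ∞ :=
    (measure_eq_zero_iff_ae_notMem.1 h_fin).mono fun ω hω => lt_top_iff_ne_top.2 hω
  have h_tfae := hM.followsUntil.tfae_lintegral_lt_top hγ hz hM.conditionM hH_int
    (integrableOn_jumpValue hγ hH_int hL_int.integrableOn)
  refine ⟨endMass (P.map γ) F H, hM.conditionM.tendsto_endMass hH_int.integrableOn,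
    hasType2a_iff hM hγ hA h_lt hH_int hL_int, hasType2b_iff hM hγ hA h_lt hH_int hL_int,
    and_congr (isUIMartingale_iff hM hγ hA h_lt hH_int hL_int) ?_, h_tfae.out 0 2⟩
  rw [← not_iff_not, ← ne_eq, ← ne_eq, ← lt_top_iff_ne_top, ← lt_top_iff_ne_top]
  exact h_tfae.out 1 2

end FiniteJumpTime

/-! ### Construction of local martingales -/

section Construction

variable {Ω : Type*} [mΩ : MeasurableSpace Ω] {P : Measure Ω} {γ : Ω → ℝ≥0∞} {F : ℝ≥0 → ℝ}
  {X : Ω → ℝ} {M : ℝ≥0 → Ω → ℝ}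

lemma aecadlag_of_eq_floor (hM : ∀ t ω, M t ω = M ⌊t⌋₊ ω) : AECadlag P M := by
  refine .of_forall fun ω t => ⟨?_, M (⌈t⌉₊ - 1 : ℕ) ω, ?_⟩
  · exact tendsto_const_nhds.congr' ((eventually_floor_eq t).mono fun s hs => by
      simp only [hM t ω, hM s ω, hs])
  · exact tendsto_const_nhds.congr' ((eventually_floor_eq_ceil_sub_one t).mono fun s hs => by
      simp only [hM s ω, hs])

lemma isLocalMartingale_of_martingale [IsFiniteMeasure P] {𝓕 : Filtration ℝ≥0 mΩ}
    (hM : Martingale M 𝓕 P) (h_cadlag : AECadlag P M) : IsLocalMartingale 𝓕 P M := by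
  refine ⟨hM.1, h_cadlag, fun n _ => ((n : ℝ≥0) : WithTop ℝ≥0),
    ⟨⟨fun n => isStoppingTime_const 𝓕 (n : ℝ≥0), .of_forall fun _ =>
      WithTop.tendsto_coe_atTop.comp tendsto_natCast_atTop_atTop⟩,
      .of_forall fun _ _ _ h => WithTop.coe_le_coe.2 (Nat.cast_le.2 h)⟩, fun n => ?_⟩
  have h_stopped : stoppedProcess M (fun _ => ((n : ℝ≥0) : WithTop ℝ≥0)) =
      fun t => M (min t n) := by
    ext t ω
    rw [stoppedProcess, ← WithTop.coe_min]
    rfl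
  rw [h_stopped]
  refine isUIMartingale_of_condExp_eq (hM.integrable n)
    (fun t => (hM.1 (min t n)).mono (𝓕.mono (min_le_left _ _))) fun t => ?_
  rcases le_total t n with ht | ht
  · rw [min_eq_left ht]
    exact hM.2 t n ht
  · rw [min_eq_right ht, condExp_of_stronglyMeasurable (𝓕.le t) ((hM.1 n).mono (𝓕.mono ht))
      (hM.integrable n)]

lemma FollowsUntil.setIntegral_lt_eq [IsFiniteMeasure P] (hM : FollowsUntil P γ F X M)
    (hγ : Measurable γ) {s t : ℝ≥0} (hst : s ≤ t) (hX : IntegrableOn X {ω | γ ω ≤ t} P) :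
    ∫ ω in {ω | (s : ℝ≥0∞) < γ ω}, M t ω ∂P =
      F t * P.real {ω | (t : ℝ≥0∞) < γ ω} + ∫ ω in γ ⁻¹' Ioc (s : ℝ≥0∞) t, X ω ∂P := by
  have h_le : MeasurableSet {ω | γ ω ≤ t} := measurableSet_le hγ measurable_const
  have h_lt : MeasurableSet {ω | (t : ℝ≥0∞) < γ ω} := measurableSet_lt measurable_const hγ
  have h_sub : {ω | (t : ℝ≥0∞) < γ ω} ⊆ {ω | (s : ℝ≥0∞) < γ ω} := fun ω hω =>
    (ENNReal.coe_le_coe.2 hst).trans_lt hω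
  rw [integral_congr_ae (ae_restrict_of_ae (hM.ae_eq_add_indicator t)),
    integral_add' ((integrable_indicator_iff h_le).2 hX).integrableOn
      ((integrable_const _).indicator h_lt).integrableOn,
    setIntegral_indicator h_le, setIntegral_indicator h_lt, inter_eq_right.2 h_sub,
    setIntegral_const, smul_eq_mul, add_comm, mul_comm]
  rfl

lemma FollowsUntil.martingale [IsFiniteMeasure P] (hM : FollowsUntil P γ F X M)
    (hγ : Measurable γ) (h_adapted : StronglyAdapted (singleJumpFiltration γ) M)
    (hX : ∀ t : ℝ≥0, IntegrableOn X {ω | γ ω ≤ t} P)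
    (h_eq : ∀ s t : ℝ≥0, s ≤ t →
      F t * P.real {ω | (t : ℝ≥0∞) < γ ω} + ∫ ω in γ ⁻¹' Ioc (s : ℝ≥0∞) t, X ω ∂P =
        F s * P.real {ω | (s : ℝ≥0∞) < γ ω}) :
    Martingale M (singleJumpFiltration γ) P := by
  have h_int (t : ℝ≥0) : Integrable (M t) P := hM.integrable hγ (hX t)
  refine ⟨h_adapted, fun s t hst => ?_⟩
  have h_mean : ∫ ω in {ω | (s : ℝ≥0∞) < γ ω}, M t ω ∂P =
      ∫ ω in {ω | (s : ℝ≥0∞) < γ ω}, M s ω ∂P := by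
    rw [hM.setIntegral_lt_eq hγ hst (hX t), hM.setIntegral_lt_eq hγ le_rfl (hX s), h_eq s t hst,
      Ioc_self, preimage_empty, setIntegral_empty, add_zero]
  exact (condExp_le_of_setIntegral_le (h_int t) (h_int s) (h_adapted s) (hM.eq_of_le_of_le hst)
    h_mean.le).antisymm (le_condExp_of_setIntegral_le (h_int t) (h_int s) (h_adapted s)
      (hM.eq_of_le_of_le hst) h_mean.ge)

open Classical in
/-- The process that follows `F` before `γ` and is equal to `X` from `γ` on. -/
noncomputable def jumpProcess (γ : Ω → ℝ≥0∞) (F : ℝ≥0 → ℝ) (X : Ω → ℝ) (t : ℝ≥0) (ω : Ω) : ℝ :=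
  if (t : ℝ≥0∞) < γ ω then F t else X ω

lemma followsUntil_jumpProcess : FollowsUntil P γ F X (jumpProcess γ F X) :=
  .of_forall fun ω t => by simp only [jumpProcess]

lemma stronglyAdapted_jumpProcess (hγ : Measurable γ) (hX : Measurable X) :
    StronglyAdapted (singleJumpFiltration γ) (jumpProcess γ F X) := by
  intro t
  have h_meas : Measurable (jumpProcess γ F X t) :=
    Measurable.ite (measurableSet_lt measurable_const hγ) measurable_const hX
  suffices Measurable[singleJumpFiltration γ t] (jumpProcess γ F X t) from this.stronglyMeasurable
  refine fun B hB => measurableSet_singleJumpFiltration.2 ⟨h_meas hB, ?_⟩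
  have h_mem {ω : Ω} (hω : (t : ℝ≥0∞) < γ ω) : ω ∈ jumpProcess γ F X t ⁻¹' B ↔ F t ∈ B := by
    rw [mem_preimage, jumpProcess, if_pos hω]
  by_cases hF : F t ∈ B
  · exact .inr (inter_eq_right.2 fun ω hω => (h_mem hω).2 hF)
  · exact .inl (eq_empty_of_forall_notMem fun ω hω => hF ((h_mem hω.2).1 hω.1))

lemma condExpZero_zero (P : Measure Ω) (γ : Ω → ℝ≥0∞) : CondExpZero P γ fun _ => 0 := by
  refine ⟨?_, ?_⟩
  · have h_zero : condLExp (MeasurableSpace.comap γ inferInstance) P (fun _ => (0 : ℝ≥0∞)) = 0 :=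
      condLExp_zero P
    simp only [enorm_zero, h_zero, Pi.zero_apply, ENNReal.zero_lt_top, eventually_true]
  · simp only [neg_zero, EventuallyEq.rfl]

end Construction

/-! ### Examples with a geometric jump time -/

/-- The geometric law on `ℕ` with parameter `1 / 2`. -/
noncomputable def geomLaw : Measure ℕ := geometricMeasure ⟨1 / 2, by norm_num, by norm_num⟩

instance : IsProbabilityMeasure geomLaw := isProbabilityMeasure_geometricMeasure

/-- The number `2⁻ⁿ⁻¹`, which is both the mass at `n` and the tail beyond `n` of `geomLaw`. -/
noncomputable def geomWeight (n : ℕ) : ℝ := (1 / 2) ^ (n + 1)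

lemma geomWeight_pos (n : ℕ) : 0 < geomWeight n := by unfold geomWeight; positivity

lemma geomLaw_real_singleton (n : ℕ) : geomLaw.real {n} = geomWeight n := by
  rw [geomLaw, geometricMeasure_real_singleton (by simp [← Subtype.coe_ne_coe]), geomWeight]
  norm_num [pow_succ]

lemma geomLaw_real_Ioi (n : ℕ) : geomLaw.real (Ioi n) = geomWeight n := by
  have h_compl : Ioi n = ((Finset.range (n + 1) : Finset ℕ) : Set ℕ)ᶜ := by
    ext k
    simp
  have h_sum : ∑ k ∈ Finset.range (n + 1), geomWeight k = 1 - geomWeight n :=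
    Finset.sum_range_induction _ (fun k => 1 - (1 / 2) ^ k) (by simp)
      _ fun k _ => by rw [geomWeight]; ring
  rw [h_compl, probReal_compl_eq_one_sub (Finset.measurableSet _), ← sum_measureReal_singleton]
  simp only [geomLaw_real_singleton, h_sum, sub_sub_cancel]

/-- The jump time of the examples: the outcome of `geomLaw`, as an element of `[0, ∞]`. -/
noncomputable def geomTime (n : ℕ) : ℝ≥0∞ := ((n : ℝ≥0) : ℝ≥0∞)

lemma measurable_geomTime : Measurable geomTime := measurable_of_countable _

lemma toNNReal_geomTime (n : ℕ) : (geomTime n).toNNReal = n := ENNReal.toNNReal_coe _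

lemma geomTime_lt_top (n : ℕ) : geomTime n < ∞ := ENNReal.coe_lt_top

lemma coe_lt_geomTime_iff {t : ℝ≥0} {n : ℕ} : (t : ℝ≥0∞) < geomTime n ↔ ⌊t⌋₊ < n := by
  rw [geomTime, ENNReal.coe_lt_coe, Nat.floor_lt zero_le]

lemma geomTime_le_coe_iff {t : ℝ≥0} {n : ℕ} : geomTime n ≤ t ↔ n ≤ ⌊t⌋₊ := by
  rw [← not_lt, coe_lt_geomTime_iff, not_lt]

lemma geomTime_preimage_Ioc (s t : ℝ≥0) :
    geomTime ⁻¹' Ioc (s : ℝ≥0∞) t = Ioc ⌊s⌋₊ ⌊t⌋₊ := by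
  ext n
  simp only [mem_preimage, mem_Ioc, coe_lt_geomTime_iff, geomTime_le_coe_iff]

lemma integrableOn_geomTime_le (X : ℕ → ℝ) (t : ℝ≥0) :
    IntegrableOn X {n | geomTime n ≤ t} geomLaw :=
  .of_finite ((finite_Iic ⌊t⌋₊).subset fun _ hn => geomTime_le_coe_iff.1 hn)

instance : IsProbabilityMeasure (geomLaw.map geomTime) :=
  Measure.isProbabilityMeasure_map measurable_geomTime.aemeasurable

lemma tailG_geom (t : ℝ≥0) : tailG (geomLaw.map geomTime) t = geomWeight ⌊t⌋₊ := by
  rw [tailG_map measurable_geomTime, ← geomLaw_real_Ioi]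
  simp only [coe_lt_geomTime_iff, Ioi]

lemma beforeEnd_geom : beforeEnd (geomLaw.map geomTime) = univ :=
  eq_univ_of_forall fun t => mem_beforeEnd_iff.2 (by rw [tailG_geom]; exact geomWeight_pos _)

lemma measure_geomTime_pos : 0 < geomLaw {n | 0 < geomTime n} := by
  have h := geomLaw_real_Ioi 0 ▸ geomWeight_pos 0
  refine (ENNReal.toReal_pos_iff.1 h).1.trans_le (measure_mono fun n hn => ?_)
  exact ENNReal.coe_pos.2 (Nat.cast_pos.2 hn)

/-- The `dG`-density, for a geometric jump time, of the step function with values `a n` on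
`[n, n + 1)`. By truncated subtraction it vanishes on `[0, 1)`, where its value is irrelevant. -/
noncomputable def stepDensity (a : ℕ → ℝ) (t : ℝ≥0) : ℝ :=
  (a ⌊t⌋₊ - a (⌊t⌋₊ - 1)) / geomWeight ⌊t⌋₊

lemma measurable_stepDensity (a : ℕ → ℝ) : Measurable (stepDensity a) :=
  (measurable_of_countable fun n => (a n - a (n - 1)) / geomWeight n).comp Nat.measurable_floor

lemma memL1loc_stepDensity (a : ℕ → ℝ) : MemL1loc (geomLaw.map geomTime) (stepDensity a) := by
  refine ⟨(measurable_stepDensity a).comp measurable_subtype_coe, fun t _ => ?_⟩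
  rw [integrableOn_dG_map measurable_geomTime measurableSet_Iic
    (measurable_stepDensity a).aestronglyMeasurable, ENNReal.image_coe_Iic]
  exact integrableOn_geomTime_le _ t

lemma setIntegral_stepDensity (a : ℕ → ℝ) {s t : ℝ≥0} (hst : s ≤ t) :
    ∫ n in geomTime ⁻¹' Ioc (s : ℝ≥0∞) t, stepDensity a (geomTime n).toNNReal ∂geomLaw =
      a ⌊t⌋₊ - a ⌊s⌋₊ := by
  rw [geomTime_preimage_Ioc, ← Finset.coe_Ioc, setIntegral_finset _ IntegrableOn.finset,
    ← Finset.Ico_add_one_add_one_eq_Ioc, ← Finset.sum_Ico_add' _ _ _ 1,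
    ← Finset.sum_Ico_sub a (Nat.floor_mono hst)]
  refine Finset.sum_congr rfl fun n _ => ?_
  rw [geomLaw_real_singleton, toNNReal_geomTime, stepDensity, Nat.floor_natCast, smul_eq_mul,
    mul_div_cancel₀ _ (geomWeight_pos _).ne', Nat.add_sub_cancel]

lemma setIntegral_dG_stepDensity (a : ℕ → ℝ) (t : ℝ≥0) :
    ∫ x in Ioc 0 t, stepDensity a x ∂(dG (geomLaw.map geomTime)) = a ⌊t⌋₊ - a 0 := by
  rw [setIntegral_dG_map measurable_geomTime measurableSet_Ioc
    (measurable_stepDensity a).aestronglyMeasurable, ENNReal.image_coe_Ioc,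
    setIntegral_stepDensity a zero_le, Nat.floor_zero]

lemma isDensity_stepDensity (a : ℕ → ℝ) :
    IsDensity (geomLaw.map geomTime) (fun t => a ⌊t⌋₊) (stepDensity a) :=
  ⟨memL1loc_stepDensity a, fun t _ => by
    simp only [setIntegral_dG_stepDensity, Nat.floor_zero, add_sub_cancel]⟩

lemma lintegral_dG_geom (g : ℕ → ℝ≥0∞) :
    ∫⁻ s in beforeEnd (geomLaw.map geomTime), g ⌊s⌋₊ ∂(dG (geomLaw.map geomTime)) =
      ∑' n, g n * ENNReal.ofReal (geomWeight n) := by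
  have hg : Measurable fun s : ℝ≥0 => g ⌊s⌋₊ :=
    (measurable_of_countable g).comp Nat.measurable_floor
  rw [beforeEnd_geom, Measure.restrict_univ, lintegral_dG_map measurable_geomTime hg.aemeasurable]
  simp only [geomTime_lt_top, ofPred_true, Measure.restrict_univ, lintegral_countable',
    toNNReal_geomTime, Nat.floor_natCast]
  exact tsum_congr fun n => by rw [← geomLaw_real_singleton, ofReal_measureReal]

/-- For a geometric jump time, the function `F` with `F(t) (1 - G(t)) = u n` on `[n, n + 1)`. -/
noncomputable def geomF (u : ℕ → ℝ) (t : ℝ≥0) : ℝ := u ⌊t⌋₊ / geomWeight ⌊t⌋₊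

/-- The function `H` that Condition M pairs with `geomF u`. -/
noncomputable def geomH (u : ℕ → ℝ) : ℝ≥0 → ℝ := stepDensity (-u)

/-- The local martingale with `F = geomF u`, `H = geomH u` and `L' = 0`. -/
noncomputable def geomMartingale (u : ℕ → ℝ) : ℝ≥0 → ℕ → ℝ :=
  jumpProcess geomTime (geomF u) (jumpValue geomTime (geomH u) fun _ => 0)

lemma geomF_mul_tailG (u : ℕ → ℝ) (t : ℝ≥0) :
    geomF u t * tailG (geomLaw.map geomTime) t = u ⌊t⌋₊ := by
  rw [tailG_geom, geomF, div_mul_cancel₀ _ (geomWeight_pos _).ne']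

lemma isDensity_geomF (u : ℕ → ℝ) :
    IsDensity (geomLaw.map geomTime) (geomF u) (stepDensity fun n => u n / geomWeight n) :=
  isDensity_stepDensity fun n => u n / geomWeight n

lemma conditionM_geom (u : ℕ → ℝ) :
    ConditionM (geomLaw.map geomTime) (geomF u) (geomH u) where
  absCont := ⟨_, isDensity_geomF u⟩
  memL1loc := memL1loc_stepDensity _
  main t _ := by
    rw [geomF_mul_tailG, geomF_mul_tailG, geomH, setIntegral_dG_stepDensity, Nat.floor_zero]
    simp only [Pi.neg_apply, sub_neg_eq_add, add_neg_cancel_left]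
  mainB hB := absurd (caseA_of_beforeEnd_eq_univ beforeEnd_geom) hB.ne'

lemma aecadlag_geomMartingale (u : ℕ → ℝ) : AECadlag geomLaw (geomMartingale u) :=
  aecadlag_of_eq_floor fun t n => by
    simp only [geomMartingale, jumpProcess, coe_lt_geomTime_iff, geomF, Nat.floor_natCast]

lemma martingale_geomMartingale (u : ℕ → ℝ) :
    Martingale (geomMartingale u) (singleJumpFiltration geomTime) geomLaw := by
  refine followsUntil_jumpProcess.martingale measurable_geomTime
    (stronglyAdapted_jumpProcess measurable_geomTime (measurable_of_countable _))
    (integrableOn_geomTime_le _) fun s t hst => ?_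
  simp only [← tailG_map measurable_geomTime, geomF_mul_tailG, jumpValue, add_zero]
  rw [geomH, setIntegral_stepDensity _ hst]
  simp only [Pi.neg_apply]
  ring

lemma isRepresentedLocalMartingale_geom (u : ℕ → ℝ) :
    IsRepresentedLocalMartingale geomLaw geomTime (geomF u) (geomH u) (fun _ => 0)
      (geomMartingale u) where
  localMartingale :=
    isLocalMartingale_of_martingale (martingale_geomMartingale u) (aecadlag_geomMartingale u)
  conditionM := conditionM_geom u
  measurable_L' := measurable_const
  integrableOn_L' _ _ := integrableOn_zero
  condExpZero_L' := condExpZero_zero _ _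
  representation := .of_forall fun n t => by
    by_cases ht : (t : ℝ≥0∞) < geomTime n
    · simp [indicator, geomMartingale, jumpProcess, ht, not_le.2 ht]
    · simp [indicator, geomMartingale, jumpProcess, ht, not_lt.1 ht, jumpValue]

lemma lintegral_geomH (u : ℕ → ℝ) :
    ∫⁻ s in beforeEnd (geomLaw.map geomTime), ‖geomH u s‖ₑ ∂(dG (geomLaw.map geomTime)) =
      ∑' n, ‖u n - u (n - 1)‖ₑ := by
  refine (lintegral_dG_geom fun n => ‖((-u) n - (-u) (n - 1)) / geomWeight n‖ₑ).trans
    (tsum_congr fun n => ?_)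
  rw [← Real.enorm_of_nonneg (geomWeight_pos n).le, ← enorm_mul,
    div_mul_cancel₀ _ (geomWeight_pos n).ne', Pi.neg_apply, Pi.neg_apply, neg_sub_neg,
    enorm_sub_rev]

lemma lintegral_tailG_mul_geom (u : ℕ → ℝ) :
    ∫⁻ s in beforeEnd (geomLaw.map geomTime), ENNReal.ofReal (tailG (geomLaw.map geomTime) s *
      |stepDensity (fun n => u n / geomWeight n) s|) ∂(dG (geomLaw.map geomTime)) =
      ∑' n, ‖geomWeight n * (u n / geomWeight n - u (n - 1) / geomWeight (n - 1))‖ₑ := by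
  simp only [tailG_geom]
  refine (lintegral_dG_geom fun n => ENNReal.ofReal (geomWeight n *
    |(u n / geomWeight n - u (n - 1) / geomWeight (n - 1)) / geomWeight n|)).trans
    (tsum_congr fun n => ?_)
  have h_pos := geomWeight_pos n
  rw [← ENNReal.ofReal_mul (by positivity), Real.enorm_eq_ofReal_abs, abs_div, abs_mul,
    abs_of_pos h_pos, mul_assoc, div_mul_cancel₀ _ h_pos.ne']

lemma hasType1_geomMartingale {u : ℕ → ℝ} (hu : ∑' n, ‖u n - u (n - 1)‖ₑ = ∞) :
    HasType (singleJumpFiltration geomTime) geomLaw (geomMartingale u) .type1 :=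
  (hasType1_iff measurable_geomTime (isRepresentedLocalMartingale_geom u)
    (caseA_of_beforeEnd_eq_univ beforeEnd_geom)).2 (.inr (by rw [lintegral_geomH, hu]))

lemma types_geomMartingale {u : ℕ → ℝ} {l : ℝ} (hu : ∑' n, ‖u n - u (n - 1)‖ₑ < ∞)
    (hl : Tendsto u atTop (𝓝 l)) :
    (HasType (singleJumpFiltration geomTime) geomLaw (geomMartingale u) .type2a ↔ 0 < l) ∧
    (HasType (singleJumpFiltration geomTime) geomLaw (geomMartingale u) .type2b ↔ l < 0) ∧
    (HasType (singleJumpFiltration geomTime) geomLaw (geomMartingale u) .type3 ↔ (l = 0 ∧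
      ∑' n, ‖geomWeight n * (u n / geomWeight n - u (n - 1) / geomWeight (n - 1))‖ₑ = ∞)) ∧
    (HasType (singleJumpFiltration geomTime) geomLaw (geomMartingale u) .type4 ↔
      ∑' n, ‖geomWeight n * (u n / geomWeight n - u (n - 1) / geomWeight (n - 1))‖ₑ < ∞) := by
  obtain ⟨l', hl', h_types⟩ := types_of_finite (isRepresentedLocalMartingale_geom u)
    measurable_geomTime (caseA_of_beforeEnd_eq_univ beforeEnd_geom)
    (by simp [(geomTime_lt_top _).ne]) (by simp) (by rwa [lintegral_geomH]) (isDensity_geomF u)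
  have h_floor : Tendsto (fun t : ℝ≥0 => u ⌊t⌋₊) atTop (𝓝 l') :=
    (hl'.mono_left (atTop_le_toEnd beforeEnd_geom)).congr (geomF_mul_tailG u)
  have h_lim : l' = l := tendsto_nhds_unique h_floor (hl.comp tendsto_nat_floor_atTop)
  rwa [lintegral_tailG_mul_geom, h_lim] at h_types

lemma enorm_le_two_mul_enorm_geomWeight_add (u : ℕ → ℝ) (n : ℕ) :
    ‖u n‖ₑ ≤ 2 * (‖geomWeight (n + 1) * (u (n + 1) / geomWeight (n + 1) - u n / geomWeight n)‖ₑ +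
      ‖u (n + 1) - u n‖ₑ) := by
  have h_pos := geomWeight_pos n
  have h_succ : geomWeight (n + 1) = geomWeight n / 2 := by unfold geomWeight; ring
  have h_eq : u n = 2 * (geomWeight (n + 1) *
      (u (n + 1) / geomWeight (n + 1) - u n / geomWeight n) - (u (n + 1) - u n)) := by
    rw [h_succ]
    field_simp
    ring
  calc ‖u n‖ₑ = 2 * ‖geomWeight (n + 1) *
        (u (n + 1) / geomWeight (n + 1) - u n / geomWeight n) - (u (n + 1) - u n)‖ₑ := by
        conv_lhs => rw [h_eq, enorm_mul, Real.enorm_of_nonneg zero_le_two, ENNReal.ofReal_ofNat]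
    _ ≤ _ := by gcongr; exact enorm_sub_le

lemma tsum_geomWeight_mul_eq_top {u : ℕ → ℝ} (hu : ∑' n, ‖u n - u (n - 1)‖ₑ < ∞)
    (h_top : ∑' n, ‖u n‖ₑ = ∞) :
    ∑' n, ‖geomWeight n * (u n / geomWeight n - u (n - 1) / geomWeight (n - 1))‖ₑ = ∞ := by
  by_contra h_ne
  have h_shift (f : ℕ → ℝ≥0∞) : ∑' n, f (n + 1) ≤ ∑' n, f n :=
    ENNReal.tsum_comp_le_tsum_of_injective (add_left_injective 1) f
  refine h_top.not_lt ?_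
  calc ∑' n, ‖u n‖ₑ
      ≤ ∑' n, 2 * (‖geomWeight (n + 1) *
          (u (n + 1) / geomWeight (n + 1) - u n / geomWeight n)‖ₑ + ‖u (n + 1) - u n‖ₑ) :=
        ENNReal.tsum_le_tsum (enorm_le_two_mul_enorm_geomWeight_add u)
    _ ≤ 2 * (∑' n, ‖geomWeight n * (u n / geomWeight n - u (n - 1) / geomWeight (n - 1))‖ₑ +
          ∑' n, ‖u n - u (n - 1)‖ₑ) := by
        rw [ENNReal.tsum_mul_left, ENNReal.tsum_add]
        gcongr 2 * (?_ + ?_)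
        · exact h_shift fun n =>
            ‖geomWeight n * (u n / geomWeight n - u (n - 1) / geomWeight (n - 1))‖ₑ
        · exact h_shift fun n => ‖u n - u (n - 1)‖ₑ
    _ < ∞ := ENNReal.mul_lt_top ENNReal.ofNat_lt_top
        (ENNReal.add_lt_top.2 ⟨lt_top_iff_ne_top.2 h_ne, hu⟩)

lemma hasType1_geomMartingale_natCast : HasType (singleJumpFiltration geomTime) geomLaw
    (geomMartingale fun n => n) .type1 := by
  refine hasType1_geomMartingale (top_unique ?_)
  calc (∞ : ℝ≥0∞) = ∑' _ : ℕ, 1 := (ENNReal.tsum_const_eq_top_of_ne_zero one_ne_zero).symm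
    _ = ∑' n : ℕ, ‖((n + 1 : ℕ) : ℝ) - ((n + 1 - 1 : ℕ) : ℝ)‖ₑ := by simp
    _ ≤ ∑' n : ℕ, ‖(n : ℝ) - ((n - 1 : ℕ) : ℝ)‖ₑ :=
      ENNReal.tsum_comp_le_tsum_of_injective (add_left_injective 1)
        fun n : ℕ => ‖(n : ℝ) - ((n - 1 : ℕ) : ℝ)‖ₑ

lemma hasType2a_geomMartingale_one : HasType (singleJumpFiltration geomTime) geomLaw
    (geomMartingale fun _ => 1) .type2a :=
  (types_geomMartingale (by simp) tendsto_const_nhds).1.2 one_pos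

lemma hasType2b_geomMartingale_neg_one : HasType (singleJumpFiltration geomTime) geomLaw
    (geomMartingale fun _ => -1) .type2b :=
  (types_geomMartingale (by simp) tendsto_const_nhds).2.1.2 neg_one_lt_zero

lemma hasType3_geomMartingale_one_div : HasType (singleJumpFiltration geomTime) geomLaw
    (geomMartingale fun n => 1 / (n + 1)) .type3 := by
  have h_anti : Antitone fun n : ℕ => 1 / ((n : ℝ) + 1) := fun m n h => by
    dsimp only
    gcongr
  have h_var := tsum_enorm_sub_lt_top_of_antitone h_anti fun n => by positivity
  refine (types_geomMartingale h_var tendsto_one_div_add_atTop_nhds_zero_nat).2.2.1.2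
    ⟨rfl, tsum_geomWeight_mul_eq_top h_var ?_⟩
  by_contra h_ne
  have h_summable : Summable fun n : ℕ => 1 / ((n + 1 : ℕ) : ℝ) :=
    (ENNReal.summable_toReal h_ne).congr fun n => by
      rw [toReal_enorm, Real.norm_of_nonneg (by positivity), Nat.cast_succ]
  exact Real.not_summable_one_div_natCast ((summable_nat_add_iff 1).1 h_summable)

lemma hasType4_geomMartingale_geomWeight : HasType (singleJumpFiltration geomTime) geomLaw
    (geomMartingale geomWeight) .type4 := by
  have h_anti : Antitone geomWeight := fun m n h =>
    pow_le_pow_of_le_one (by norm_num) (by norm_num) (Nat.succ_le_succ h)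
  have h_lim : Tendsto geomWeight atTop (𝓝 0) :=
    (tendsto_pow_atTop_nhds_zero_of_lt_one (by norm_num) (by norm_num)).comp
      (tendsto_add_atTop_nat 1)
  refine (types_geomMartingale (tsum_enorm_sub_lt_top_of_antitone h_anti fun n =>
    (geomWeight_pos n).le) h_lim).2.2.2.2 ?_
  simp [div_self (geomWeight_pos _).ne']

lemma exists_hasType (k : GlobalType) :
    ∃ (Ω : Type) (_ : MeasurableSpace Ω) (P : Measure Ω) (_ : IsProbabilityMeasure P)
      (γ : Ω → ℝ≥0∞) (F H : ℝ≥0 → ℝ) (L' : Ω → ℝ) (M : ℝ≥0 → Ω → ℝ),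
      Measurable γ ∧ 0 < P {ω | 0 < γ ω} ∧ IsRepresentedLocalMartingale P γ F H L' M ∧
      CaseA (P.map γ) ∧ HasType (singleJumpFiltration γ) P M k := by
  obtain ⟨u, hu⟩ : ∃ u, HasType (singleJumpFiltration geomTime) geomLaw (geomMartingale u) k := by
    cases k
    exacts [⟨_, hasType1_geomMartingale_natCast⟩, ⟨_, hasType2a_geomMartingale_one⟩,
      ⟨_, hasType2b_geomMartingale_neg_one⟩, ⟨_, hasType3_geomMartingale_one_div⟩,
      ⟨_, hasType4_geomMartingale_geomWeight⟩]
  exact ⟨ℕ, inferInstance, geomLaw, inferInstance, geomTime, _, _, _, _, measurable_geomTime,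
    measure_geomTime_pos, isRepresentedLocalMartingale_geom u,
    caseA_of_beforeEnd_eq_univ beforeEnd_geom, hu⟩

end SingleJump

/-- Classification of the local martingales of a single jump filtration by their global behaviour:
Case B; Case A, parts (i), (ii), (iii); and the realizability in Case A of every type. -/
theorem theorem4 :
    (∀ (Ω : Type*) [MeasurableSpace Ω] (P : Measure Ω) [IsProbabilityMeasure P]
      (γ : Ω → ℝ≥0∞) (_ : Measurable γ) (_ : 0 < P {ω | 0 < γ ω})
      (F H : ℝ≥0 → ℝ) (L' : Ω → ℝ) (M : ℝ≥0 → Ω → ℝ)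
      (_ : SingleJump.IsRepresentedLocalMartingale P γ F H L' M),
      (SingleJump.CaseB (P.map γ) →
        SingleJump.HasType (SingleJump.singleJumpFiltration γ) P M .type4) ∧
      (SingleJump.CaseA (P.map γ) →
        -- (i)
        (SingleJump.HasType (SingleJump.singleJumpFiltration γ) P M .type1 ↔
          (∫⁻ ω in {ω | γ ω < ∞}, ‖L' ω‖ₑ ∂P = ∞ ∨
            ∫⁻ s in SingleJump.beforeEnd (P.map γ), ‖H s‖ₑ ∂(SingleJump.dG (P.map γ)) = ∞)) ∧
        -- (ii)
        (0 < P {ω | γ ω = ∞} →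
          ∫⁻ ω in {ω | γ ω < ∞}, ‖L' ω‖ₑ ∂P < ∞ →
          ∫⁻ s, ‖H s‖ₑ ∂(SingleJump.dG (P.map γ)) < ∞ →
          SingleJump.HasType (SingleJump.singleJumpFiltration γ) P M .type4) ∧
        -- (iii)
        (P {ω | γ ω = ∞} = 0 →
          ∫⁻ ω, ‖L' ω‖ₑ ∂P < ∞ →
          ∫⁻ s in SingleJump.beforeEnd (P.map γ), ‖H s‖ₑ ∂(SingleJump.dG (P.map γ)) < ∞ →
          ∀ z : ℝ≥0 → ℝ, SingleJump.IsDensity (P.map γ) F z →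
          ∃ l : ℝ,
            Tendsto (fun t => F t * SingleJump.tailG (P.map γ) t)
              (SingleJump.toEnd (P.map γ)) (𝓝 l) ∧
            (SingleJump.HasType (SingleJump.singleJumpFiltration γ) P M .type2a ↔ 0 < l) ∧
            (SingleJump.HasType (SingleJump.singleJumpFiltration γ) P M .type2b ↔ l < 0) ∧
            (SingleJump.HasType (SingleJump.singleJumpFiltration γ) P M .type3 ↔
              (l = 0 ∧
                ∫⁻ s in SingleJump.beforeEnd (P.map γ),
                  ENNReal.ofReal (SingleJump.tailG (P.map γ) s * |z s|)
                    ∂(SingleJump.dG (P.map γ)) = ∞)) ∧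
            (SingleJump.HasType (SingleJump.singleJumpFiltration γ) P M .type4 ↔
              ∫⁻ s in SingleJump.beforeEnd (P.map γ),
                ENNReal.ofReal (SingleJump.tailG (P.map γ) s * |z s|)
                  ∂(SingleJump.dG (P.map γ)) < ∞)))) ∧
    -- in Case A all types are possible
    (∀ k : SingleJump.GlobalType,
      ∃ (Ω : Type) (_ : MeasurableSpace Ω) (P : Measure Ω) (_ : IsProbabilityMeasure P)
        (γ : Ω → ℝ≥0∞) (F H : ℝ≥0 → ℝ) (L' : Ω → ℝ) (M : ℝ≥0 → Ω → ℝ),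
        Measurable γ ∧ 0 < P {ω | 0 < γ ω} ∧
        SingleJump.IsRepresentedLocalMartingale P γ F H L' M ∧
        SingleJump.CaseA (P.map γ) ∧
        SingleJump.HasType (SingleJump.singleJumpFiltration γ) P M k) := by
  refine ⟨?_, SingleJump.exists_hasType⟩
  intro Ω _ P _ γ hγ _ F H L' M hM
  exact ⟨SingleJump.hasType4_of_caseB hγ hM, fun hA => ⟨SingleJump.hasType1_iff hγ hM hA,
    SingleJump.hasType4_of_eq_top_pos hγ hM, fun h_fin hL hH z hz =>
      SingleJump.types_of_finite hM hγ hA h_fin hL hH hz⟩⟩
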